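/- **Setting.** Let $(E,\|\cdot\|_E)$ be a real Banach space with dual unit ball $B_{E'}$ and let $k\in\mathbb N=\{1,2,\dots\}$. The $k$-fold symmetric algebraic tensor product $\otimes^{k,s}E$ is the linear span in $E\otimes\cdots\otimes E$ of all symmetrizations $\frac1{k!}\sum_{\sigma\in S_k}x_{\sigma(1)}\otimes\cdots\otimes x_{\sigma(k)}$. Each of its elements has the form $U=\sum_{j}\lambda_j\otimes^k x_j$, where $\otimes^k x:=x\otimes\cdots\otimes x$, and its symmetric injective norm is $\|U\|_{\varepsilon_s}:=\sup_{f\in B_{E'}}|\sum_j\lambda_j f(x_j)^k|$. Let $\otimes^{k,s}_{\varepsilon_s}E$ denote the completion. For a probability space $(\Omega,\mathcal A,\mathbb P)$ and $\xi\in L_k(\Omega;E)$ put $\mathbb M^k_\varepsilon[\xi]:=\mathbb E[\otimes^k\xi]\in\otimes^{k,s}_{\varepsilon_s}E$ (Bochner integral). The space $E$ is of Rademacher type $p$ with constant $\tau$ if $\bigl(\mathbb E\|\sum_{j=1}^n r_jx_j\|_E^p\bigr)^{1/p}\le\tau\bigl(\sum_{j=1}^n\|x_j\|_E^p\bigr)^{1/p}$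 for all $n$, all $x_1,\dots,x_n\in E$ and all independent $r_1,\dots,r_n$ with $\mathbb P(r_j=\pm1)=\frac12$. **Theorem ($\alpha\beta\gamma$ theorem).** Let $E$ be of Rademacher type $p\in(1,2]$ with constant $\tau\in(0,\infty)$, let $p'\in[2,\infty)$ satisfy $\frac1p+\frac1{p'}=1$, and let $q\in[p,\infty)$ and $k\in\mathbb N$. Let $X\in L_k(\Omega;E)$, let $(X_\ell)_{\ell\in\mathbb N}\subset L_{kq}(\Omega;E)$, put $X_0:=0$, and define, for $\ell\in\mathbb N$, $$\xi_\ell:=\otimes^kX_\ell-\otimes^kX_{\ell-1}\in L_q(\Omega;\otimes^{k,s}_{\varepsilon_s}E).$$ Let $\mathcal C_\ell$ be the cost of generating one sample of $\xi_\ell$. Suppose that there are positive integers $(N_\ell)_{\ell\in\mathbb N}$ and constants $\alpha,\beta,\gamma,C_\alpha,C_\beta,C_\gamma,C_{\rm stab},c_1,c_2\in(0,\infty)$, $A\in(1,\infty)$ such that, for all $\ell\in\mathbb N$, $c_1A^\ell\le N_\ell\le c_2A^\ell$ and $$\|\mathbb M^k_\varepsilon[X]-\mathbb M^k_\varepsilon[X_\ell]\|_{\varepsilon_s}\le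 C_\alpha N_\ell^{-\alpha},\qquad \|X_\ell-X_{\ell-1}\|_{L_{kq}(\Omega;E)}\le C_\beta N_\ell^{-\beta},$$ $$\mathcal C_\ell\le C_\gamma N_\ell^{\gamma},\qquad \max\{\|X\|_{L_k(\Omega;E)},\|X_\ell\|_{L_{kq}(\Omega;E)}\}\le C_{\rm stab}.$$ For each $\ell\in\mathbb N$ let $(\xi_{\ell,j})_{j\in\mathbb N}\subset L_q(\Omega;\otimes^{k,s}_{\varepsilon_s}E)$ be a sequence of independent copies of $\xi_\ell$ (no independence is required across different levels $\ell$). Then for every $\epsilon\in(0,\frac12]$ there exist $L\in\mathbb N$ and $M_1,\dots,M_L\in\mathbb N$ such that $$\Bigl\|\mathbb M^k_\varepsilon[X]-\sum_{\ell=1}^L\frac1{M_\ell}\sum_{j=1}^{M_\ell}\xi_{\ell,j}\Bigr\|_{L_q(\Omega;\otimes^{k,s}_{\varepsilon_s}E)}<\epsilon$$ and the computational cost of this estimator satisfies $$\sum_{\ell=1}^L M_\ell\,\mathcal C_\ell\;\le\;K\cdot\begin{cases}\epsilon^{-\gamma/\alpha}+\epsilon^{-p'}&\text{if }\beta p'>\gamma,\\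 \epsilon^{-\gamma/\alpha}+\epsilon^{-p'}|\log_A\epsilon|^{p'+1}&\text{if }\beta p'=\gamma,\\ \epsilon^{-\gamma/\alpha}+\epsilon^{-p'-(\gamma-\beta p')/\alpha}&\text{if }\beta p'<\gamma,\end{cases}$$ where the constant $K\in(0,\infty)$ depends only on $\alpha,\beta,\gamma,A,p,q,k,C_\alpha,C_\beta,C_\gamma,C_{\rm stab},c_1,c_2$ and $\tau$. -/

import Mathlib

open MeasureTheory ProbabilityTheory
open scoped TensorProduct ENNReal

universe u v

noncomputable section

section SymmetricInjectiveTensorProduct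

variable (k : ℕ) (E : Type*) [NormedAddCommGroup E] [NormedSpace ℝ E]

/-- The symmetrization `s(x₁ ⊗ ⋯ ⊗ x_k) = (1 / k!) ∑_σ x_{σ(1)} ⊗ ⋯ ⊗ x_{σ(k)}`. -/
def symmetrization {k : ℕ} {E : Type*} [NormedAddCommGroup E] [NormedSpace ℝ E]
    (x : Fin k → E) : ⨂[ℝ] (_ : Fin k), E :=
  ((k.factorial : ℝ)⁻¹) • ∑ σ : Equiv.Perm (Fin k), PiTensorProduct.tprod ℝ (fun i => x (σ i))

/-- The symmetric tensors of order `k`, as a subspace of the algebraic tensor product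
`E ⊗ ⋯ ⊗ E`: the linear span of all symmetrizations. -/
def symmetricTensors : Submodule ℝ (⨂[ℝ] (_ : Fin k), E) :=
  Submodule.span ℝ (Set.range (symmetrization (k := k) (E := E)))

/-- The `k`-fold symmetric algebraic tensor product of `E`. It is a separate type, so that its norm
is the symmetric injective one and not one inherited from the full tensor product. -/
def SymTensor : Type _ := ↥(symmetricTensors k E)

instance SymTensor.instAddCommGroup : AddCommGroup (SymTensor k E) :=
  inferInstanceAs (AddCommGroup ↥(symmetricTensors k E))

instance SymTensor.instModule : Module ℝ (SymTensor k E) :=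
  inferInstanceAs (Module ℝ ↥(symmetricTensors k E))

variable {E}

/-- The pairing of `f ⊗ ⋯ ⊗ f` with algebraic tensors: the linear functional that maps
`x₁ ⊗ ⋯ ⊗ x_k` to `f(x₁) ⋯ f(x_k)`. -/
def evalPow (f : E →L[ℝ] ℝ) : (⨂[ℝ] (_ : Fin k), E) →ₗ[ℝ] ℝ :=
  PiTensorProduct.dualDistrib (PiTensorProduct.tprod ℝ (fun _ => (f : E →ₗ[ℝ] ℝ)))

theorem evalPow_tprod (f : E →L[ℝ] ℝ) (x : Fin k → E) :
    evalPow k f (PiTensorProduct.tprod ℝ x) = ∏ i, f (x i) := by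
  simp [evalPow]

variable (E) in
/-- The inclusion of the symmetric tensors into all tensors. -/
def SymTensor.incl : SymTensor k E →ₗ[ℝ] (⨂[ℝ] (_ : Fin k), E) :=
  (symmetricTensors k E).subtype

/-- The symmetric injective norm
`‖U‖ = sup { |⟨f ⊗ ⋯ ⊗ f, U⟩| : f in the closed unit ball of the dual of E }`;
for `U = ∑ j, λ_j • (x_j ⊗ ⋯ ⊗ x_j)` the quantity inside is `|∑ j, λ_j f(x_j)^k|`. -/
instance SymTensor.instNorm : Norm (SymTensor k E) :=
  ⟨fun U => ⨆ f : {f : E →L[ℝ] ℝ // ‖f‖ ≤ 1}, |evalPow k f.1 (SymTensor.incl k E U)|⟩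

theorem evalPow_bddAbove (U : ⨂[ℝ] (_ : Fin k), E) :
    BddAbove (Set.range fun f : {f : E →L[ℝ] ℝ // ‖f‖ ≤ 1} => |evalPow k f.1 U|) := by
  suffices h : ∃ C : ℝ, ∀ f : E →L[ℝ] ℝ, ‖f‖ ≤ 1 → |evalPow k f U| ≤ C by
    obtain ⟨C, hC⟩ := h
    exact ⟨C, by rintro _ ⟨f, rfl⟩; exact hC f.1 f.2⟩
  induction U using PiTensorProduct.induction_on with
  | smul_tprod r x =>
    refine ⟨|r| * ∏ i, ‖x i‖, fun f hf => ?_⟩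
    rw [map_smul, evalPow_tprod, smul_eq_mul, abs_mul, Finset.abs_prod]
    refine mul_le_mul_of_nonneg_left ?_ (abs_nonneg r)
    refine Finset.prod_le_prod (fun i _ => abs_nonneg _) (fun i _ => ?_)
    calc |f (x i)| ≤ ‖f‖ * ‖x i‖ := f.le_opNorm (x i)
      _ ≤ 1 * ‖x i‖ := mul_le_mul_of_nonneg_right hf (norm_nonneg _)
      _ = ‖x i‖ := one_mul _
  | add U V hU hV =>
    obtain ⟨C, hC⟩ := hU
    obtain ⟨D, hD⟩ := hV
    refine ⟨C + D, fun f hf => ?_⟩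
    rw [map_add]
    exact (abs_add_le _ _).trans (add_le_add (hC f hf) (hD f hf))

theorem SymTensor.normCore : SeminormedSpace.Core ℝ (SymTensor k E) where
  norm_nonneg U := Real.iSup_nonneg fun _ => abs_nonneg _
  norm_smul c U := by
    change (⨆ f : {f : E →L[ℝ] ℝ // ‖f‖ ≤ 1}, |evalPow k f.1 (SymTensor.incl k E (c • U))|)
      = ‖c‖ * ⨆ f : {f : E →L[ℝ] ℝ // ‖f‖ ≤ 1}, |evalPow k f.1 (SymTensor.incl k E U)|
    rw [Real.mul_iSup_of_nonneg (norm_nonneg c)]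
    simp only [map_smul, smul_eq_mul, abs_mul, Real.norm_eq_abs]
  norm_triangle U V := by
    have : Nonempty {f : E →L[ℝ] ℝ // ‖f‖ ≤ 1} := ⟨⟨0, by simp⟩⟩
    refine ciSup_le fun f => ?_
    rw [map_add, map_add]
    exact (abs_add_le _ _).trans (add_le_add
      (le_ciSup (evalPow_bddAbove k (SymTensor.incl k E U)) f)
      (le_ciSup (evalPow_bddAbove k (SymTensor.incl k E V)) f))

instance SymTensor.instSeminormedAddCommGroup : SeminormedAddCommGroup (SymTensor k E) :=
  SeminormedAddCommGroup.ofCore (SymTensor.normCore (E := E) k)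

instance SymTensor.instNormedSpace : NormedSpace ℝ (SymTensor k E) where
  norm_smul_le c U := ((SymTensor.normCore k).norm_smul c U).le

variable (E) in
/-- The `k`-fold symmetric injective tensor product of `E`: the completion of the symmetric
algebraic tensor product with respect to the symmetric injective norm. -/
abbrev SymInjTensor : Type _ := UniformSpace.Completion (SymTensor k E)

instance SymInjTensor.instMeasurableSpace : MeasurableSpace (SymInjTensor k E) := borel _

instance SymInjTensor.instBorelSpace : BorelSpace (SymInjTensor k E) := ⟨rfl⟩

theorem tprod_const_mem (x : E) :
    PiTensorProduct.tprod ℝ (fun _ : Fin k => x) ∈ symmetricTensors k E := by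
  refine Submodule.subset_span ⟨fun _ => x, ?_⟩
  have hk : ((k.factorial : ℝ)) ≠ 0 := by exact_mod_cast k.factorial_ne_zero
  simp only [symmetrization, Finset.sum_const, Finset.card_univ, Fintype.card_perm,
    Fintype.card_fin]
  rw [← Nat.cast_smul_eq_nsmul ℝ, smul_smul, inv_mul_cancel₀ hk, one_smul]

/-- The elementary tensor `x ⊗ ⋯ ⊗ x` (`k` factors) as a symmetric algebraic tensor. -/
def symPow (x : E) : SymTensor k E :=
  ⟨PiTensorProduct.tprod ℝ (fun _ : Fin k => x), tprod_const_mem k x⟩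

/-- The elementary tensor `x ⊗ ⋯ ⊗ x` (`k` factors) in the symmetric injective tensor product. -/
def tensorPow (x : E) : SymInjTensor k E := ((symPow k x : SymTensor k E) : SymInjTensor k E)

end SymmetricInjectiveTensorProduct

section Rademacher

/-- A Rademacher family: independent random variables with values in `{-1, 1}`, each value being
taken with probability `1 / 2`. -/
structure IsRademacherFamily {J S : Type*} [MeasurableSpace S] (P : Measure S)
    (r : J → S → ℝ) : Prop where
  measurable : ∀ j, Measurable (r j)
  values : ∀ j ω, r j ω = -1 ∨ r j ω = 1
  prob_neg_one : ∀ j, P {ω | r j ω = -1} = 1 / 2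
  prob_one : ∀ j, P {ω | r j ω = 1} = 1 / 2
  indep : iIndepFun r P

/-- `F` has Rademacher type `p` with constant `τ`. -/
def HasRademacherTypeWith (p τ : ℝ) (F : Type*) [NormedAddCommGroup F] [NormedSpace ℝ F] : Prop :=
  ∀ (S : Type) [MeasurableSpace S] (P : Measure S) [IsProbabilityMeasure P] [P.IsComplete]
    (n : ℕ) (r : Fin n → S → ℝ), IsRademacherFamily P r → ∀ x : Fin n → F,
    (∫ ω, ‖∑ j, r j ω • x j‖ ^ p ∂P) ^ (1 / p) ≤ τ * (∑ j, ‖x j‖ ^ p) ^ (1 / p)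

end Rademacher

section MultilevelMonteCarlo

variable {E : Type*} [NormedAddCommGroup E] [NormedSpace ℝ E]
  {Ω : Type*} [MeasurableSpace Ω]

/-- The injective `k`-th moment `𝕄ᵏ[X] = 𝔼[X ⊗ ⋯ ⊗ X]`, a Bochner integral (which exists for
`X ∈ L_k(Ω; E)`). -/
def injMoment (k : ℕ) (X : Ω → E) (μ : Measure Ω) : SymInjTensor k E :=
  ∫ ω, tensorPow k (X ω) ∂μ

/-- The level difference `ξ_ℓ = ⊗ᵏ X_ℓ - ⊗ᵏ X_{ℓ-1}`, used for `ℓ ≥ 1`. -/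
def levelDiff (k : ℕ) (X : ℕ → Ω → E) (l : ℕ) (ω : Ω) : SymInjTensor k E :=
  tensorPow k (X l ω) - tensorPow k (X (l - 1) ω)

/-- The multilevel Monte Carlo estimator `∑_{ℓ=1}^L (1 / M_ℓ) ∑_{j<M_ℓ} ξ_{ℓ,j}`. -/
def mlmcEstimator {k : ℕ} (ξ : ℕ → ℕ → Ω → SymInjTensor k E) (L : ℕ) (M : ℕ → ℕ) (ω : Ω) :
    SymInjTensor k E :=
  ∑ l ∈ Finset.Icc 1 L, ((M l : ℝ)⁻¹) • ∑ j ∈ Finset.range (M l), ξ l j ω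

/-- The cost of the multilevel Monte Carlo estimator: `M_ℓ` samples at cost `cost ℓ` each on every
level `ℓ = 1, …, L`. -/
def mlmcCost (cost : ℕ → ℝ) (L : ℕ) (M : ℕ → ℕ) : ℝ :=
  ∑ l ∈ Finset.Icc 1 L, (M l : ℝ) * cost l

/-- The order of the computational cost in terms of the accuracy `ε`, by the three cases
`β p' > γ`, `β p' = γ`, `β p' < γ`. -/
def costRate (α β γ A p' ε : ℝ) : ℝ :=
  if γ < β * p' then ε ^ (-(γ / α)) + ε ^ (-p')
  else if β * p' = γ then ε ^ (-(γ / α)) + ε ^ (-p') * |Real.logb A ε| ^ (p' + 1)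
  else ε ^ (-(γ / α)) + ε ^ (-p' - (γ - β * p') / α)

end MultilevelMonteCarlo

end

/-! The error splits into the bias on level `L` and one sampling error per level. The difficulty is
the sampling error: the injective tensor product need not inherit any type from `E`, so the type
inequality cannot be applied to `levelDiff` directly.

Instead, the injective norm is read as a supremum over the dual unit ball. A sign sum of differences
`⊗ᵏx_j - ⊗ᵏy_j` becomes a Rademacher process `f ↦ ∑ ± (f(x_j)^k - f(y_j)^k)`. With `m = max ‖x‖
‖y‖`, the increment of one summand between `f` and `g` is at most `k² m^(k-1) (‖x-y‖/m · |f(x)-g(x)|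
+ |f(x-y)-g(x-y)|)`. A contraction principle (`signAverage_iSup_le`) therefore compares the process
with one that is linear in `f`, that is, with a norm in `E` of a sign sum of multiples of `x_j` and
`x_j - y_j`. There type `p` applies, and both families have norms at most a constant times `powDist
k x_j y_j` (`signAverage_tensorPow_sub_rpow_le`).

An exponential inequality lifts the first moment of a sign sum to the `q`-th
(`signAverage_norm_rpow_le`), and symmetrization with an independent copy transfers the bound to
independent samples. With Hölder's inequality for `powDist`, level `l` has sampling error of order
`M_l^(-1/p') A^(-βl)` (`eLpNorm_monteCarlo_sub_le`, `eLpNorm_powDist_le`). What remains is an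
optimization of the `M_l`, with weights that spread the admissible error over the levels according
to the sign of `βp' - γ`. -/

noncomputable section

/-! ### Averages over finitely many signs -/

section SignAverage

/-- The average of `Φ (v ± x₁ ± ⋯ ± xₙ)` over all choices of the signs. -/
def signAverage {V : Type*} [AddCommGroup V] (Φ : V → ℝ) : List V → V → ℝ
  | [], v => Φ v
  | x :: L, v => (signAverage Φ L (v + x) + signAverage Φ L (v - x)) / 2

section AddCommGroup

variable {V : Type*} [AddCommGroup V]

/-- The predicate `P` will be boundedness: comparisons of real suprema are only meaningful for
bounded functions. -/
theorem signAverage_mono_on {P : V → Prop} {Φ Ψ : V → ℝ} (h : ∀ v, P v → Φ v ≤ Ψ v) (L : List V)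
    (hL : ∀ x ∈ L, ∀ v, P v → P (v + x) ∧ P (v - x)) (v : V) (hv : P v) :
    signAverage Φ L v ≤ signAverage Ψ L v := by
  induction L generalizing v with
  | nil => exact h v hv
  | cons x L ih =>
    have hx := hL x (by simp) v hv
    have hL' : ∀ y ∈ L, ∀ v, P v → P (v + y) ∧ P (v - y) := fun y hy => hL y (by simp [hy])
    have h1 := ih hL' _ hx.1
    have h2 := ih hL' _ hx.2
    simp only [signAverage]
    linarith

theorem signAverage_mono {Φ Ψ : V → ℝ} (h : ∀ v, Φ v ≤ Ψ v) (L : List V) (v : V) :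
    signAverage Φ L v ≤ signAverage Ψ L v :=
  signAverage_mono_on (P := fun _ => True) (fun v _ => h v) L (by simp) v trivial

theorem signAverage_add (Φ Ψ : V → ℝ) (L : List V) (v : V) :
    signAverage (fun w => Φ w + Ψ w) L v = signAverage Φ L v + signAverage Ψ L v := by
  induction L generalizing v with
  | nil => rfl
  | cons x L ih => simp only [signAverage, ih]; ring

theorem signAverage_const_mul (c : ℝ) (Φ : V → ℝ) (L : List V) (v : V) :
    signAverage (fun w => c * Φ w) L v = c * signAverage Φ L v := by
  induction L generalizing v with
  | nil => rfl
  | cons x L ih => simp only [signAverage, ih]; ring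

theorem signAverage_neg (Φ : V → ℝ) (L : List V) (v : V) :
    signAverage (fun w => Φ (-w)) L v = signAverage Φ L (-v) := by
  induction L generalizing v with
  | nil => rfl
  | cons x L ih =>
    simp only [signAverage, ih]
    rw [neg_add', neg_sub', sub_neg_eq_add, add_comm]

theorem signAverage_map {W : Type*} [AddCommGroup W] (T : W →+ V) (Φ : V → ℝ) (L : List W) (w : W) :
    signAverage Φ (L.map T) (T w) = signAverage (fun w => Φ (T w)) L w := by
  induction L generalizing w with
  | nil => rfl
  | cons x L ih => simp only [signAverage, List.map_cons, ← map_add, ← map_sub, ih]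

/-- The order of averaging is immaterial; this lets a sign be moved from the outermost to the
innermost position. -/
theorem signAverage_shift (Φ : V → ℝ) (L : List V) (x v : V) :
    signAverage (fun w => (Φ (w + x) + Φ (w - x)) / 2) L v
      = (signAverage Φ L (v + x) + signAverage Φ L (v - x)) / 2 := by
  induction L generalizing v with
  | nil => rfl
  | cons y L ih =>
    simp only [signAverage, ih]
    rw [add_right_comm v y x, add_sub_right_comm v y x, ← add_sub_right_comm v x y,
      sub_right_comm v y x]
    ring

theorem signAverage_rpow_le {Φ : V → ℝ} (hΦ : ∀ v, 0 ≤ Φ v) {p : ℝ} (hp : 1 ≤ p) (L : List V)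
    (v : V) : 0 ≤ signAverage Φ L v ∧
      signAverage Φ L v ^ p ≤ signAverage (fun w => Φ w ^ p) L v := by
  induction L generalizing v with
  | nil => exact ⟨hΦ v, le_rfl⟩
  | cons x L ih =>
    have h1 := ih (v + x)
    have h2 := ih (v - x)
    simp only [signAverage]
    refine ⟨by linarith, ?_⟩
    have h := (convexOn_rpow hp).2 (Set.mem_Ici.2 h1.1) (Set.mem_Ici.2 h2.1)
      (show (0 : ℝ) ≤ 1 / 2 by norm_num) (show (0 : ℝ) ≤ 1 / 2 by norm_num) (by norm_num)
    simp only [smul_eq_mul, ← mul_add] at h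
    rw [div_eq_inv_mul, div_eq_inv_mul, ← one_div]
    refine h.trans ?_
    gcongr
    exacts [h1.2, h2.2]

/-- The sign of a Boolean, `1` for `true` and `-1` for `false`. -/
def boolSign (b : Bool) : ℝ := if b then 1 else -1

theorem signAverage_ofFn [Module ℝ V] (Φ : V → ℝ) {n : ℕ} (x : Fin n → V) (v : V) :
    signAverage Φ (List.ofFn x) v
      = (2 ^ n : ℝ)⁻¹ * ∑ s : Fin n → Bool, Φ (v + ∑ j, boolSign (s j) • x j) := by
  induction n generalizing v with
  | zero => simp [signAverage]
  | succ n ih =>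
    rw [List.ofFn_succ, signAverage, ih, ih, ← (Fin.consEquiv fun _ => Bool).sum_comp,
      Fintype.sum_prod_type]
    simp only [Fin.consEquiv_apply, Fin.sum_univ_succ, Fin.cons_zero, Fin.cons_succ,
      Fintype.univ_bool, Finset.mem_singleton, Bool.true_eq_false, not_false_eq_true,
      Finset.sum_insert, Finset.sum_singleton, boolSign, if_true, one_smul, neg_smul,
      Bool.false_eq_true, if_false, ← add_assoc, ← sub_eq_add_neg, pow_succ, mul_inv]
    ring

end AddCommGroup

/-! ### A contraction principle for Rademacher processes -/

section Contraction

variable {I : Type*} [Nonempty I]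

/-- For each pair `i, j` one of the two increments dominates, say that of `a`. Orient its sign so
that `±(a i - a j)` is the absolute value, and evaluate the suprema at `i` or `j` accordingly; the
contributions of `b` then cancel over its two signs. -/
theorem sup_add_sup_sub_le {φ a b w : I → ℝ}
    (ha : ∃ C, ∀ i, |a i| ≤ C) (hb : ∃ C, ∀ i, |b i| ≤ C)
    (hw : ∃ C, ∀ i, |w i| ≤ C) (h : ∀ i j, |φ i - φ j| ≤ max |a i - a j| |b i - b j|) :
    ((⨆ i, (w + φ) i) + ⨆ i, (w - φ) i) / 2
      ≤ signAverage (fun u : I → ℝ => ⨆ i, u i) [a, b] w := by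
  obtain ⟨Ca, ha⟩ := ha
  obtain ⟨Cb, hb⟩ := hb
  obtain ⟨Cw, hw⟩ := hw
  have bdd : ∀ s t : ℝ, |s| ≤ 1 → |t| ≤ 1 →
      BddAbove (Set.range fun i => w i + s * a i + t * b i) := by
    intro s t hs ht
    refine ⟨Cw + Ca + Cb, ?_⟩
    rintro _ ⟨i, rfl⟩
    have h1 : s * a i ≤ Ca := by
      refine (le_abs_self _).trans ?_
      rw [abs_mul]
      nlinarith [ha i, abs_nonneg (a i), abs_nonneg s]
    have h2 : t * b i ≤ Cb := by
      refine (le_abs_self _).trans ?_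
      rw [abs_mul]
      nlinarith [hb i, abs_nonneg (b i), abs_nonneg t]
    have h3 := (le_abs_self _).trans (hw i)
    dsimp only
    linarith
  have e1 := le_ciSup (bdd 1 1 (by norm_num) (by norm_num))
  have e2 := le_ciSup (bdd 1 (-1) (by norm_num) (by norm_num))
  have e3 := le_ciSup (bdd (-1) 1 (by norm_num) (by norm_num))
  have e4 := le_ciSup (bdd (-1) (-1) (by norm_num) (by norm_num))
  simp only [one_mul, neg_mul, ← sub_eq_add_neg] at e1 e2 e3 e4
  simp only [signAverage, Pi.add_apply, Pi.sub_apply]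
  have key : ∀ i j, (w i + φ i) + (w j - φ j) ≤
      ((⨆ i, (w i + a i + b i)) + (⨆ i, (w i + a i - b i)) + ((⨆ i, (w i - a i + b i)) +
        ⨆ i, (w i - a i - b i))) / 2 := by
    intro i j
    have hij := (le_abs_self _).trans (h i j)
    have := e1 i; have := e1 j; have := e2 i; have := e2 j
    have := e3 i; have := e3 j; have := e4 i; have := e4 j
    rcases le_max_iff.1 hij with h' | h' <;>
      rcases abs_cases (a i - a j) with ⟨h1, -⟩ | ⟨h1, -⟩ <;>
      rcases abs_cases (b i - b j) with ⟨h2, -⟩ | ⟨h2, -⟩ <;> linarith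
  have s1 : ∀ j, (⨆ i, (w i + φ i)) ≤
      ((⨆ i, (w i + a i + b i)) + (⨆ i, (w i + a i - b i)) + ((⨆ i, (w i - a i + b i)) +
        ⨆ i, (w i - a i - b i))) / 2 - (w j - φ j) :=
    fun j => ciSup_le fun i => by linarith [key i j]
  have s2 : (⨆ j, (w j - φ j)) ≤
      ((⨆ i, (w i + a i + b i)) + (⨆ i, (w i + a i - b i)) + ((⨆ i, (w i - a i + b i)) +
        ⨆ i, (w i - a i - b i))) / 2 - ⨆ i, (w i + φ i) :=
    ciSup_le fun j => by linarith [s1 j]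
  linarith

/-- A contraction principle for suprema of Rademacher processes whose increments are dominated
by those of two other families. -/
theorem signAverage_iSup_le {ι : Type*} (φ a b : ι → I → ℝ)
    (hφ : ∀ j, ∃ C, ∀ i, |φ j i| ≤ C) (ha : ∀ j, ∃ C, ∀ i, |a j i| ≤ C)
    (hb : ∀ j, ∃ C, ∀ i, |b j i| ≤ C)
    (h : ∀ j i i', |φ j i - φ j i'| ≤ max |a j i - a j i'| |b j i - b j i'|)
    (L : List ι) (w : I → ℝ) (hw : ∃ C, ∀ i, |w i| ≤ C) :
    signAverage (fun u : I → ℝ => ⨆ i, u i) (L.map φ) w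
      ≤ signAverage (fun u : I → ℝ => ⨆ i, u i) (L.flatMap fun j => [a j, b j]) w := by
  have hadd : ∀ f g : I → ℝ, (∃ C, ∀ i, |f i| ≤ C) → (∃ C, ∀ i, |g i| ≤ C) →
      (∃ C, ∀ i, |(f + g) i| ≤ C) ∧ ∃ C, ∀ i, |(f - g) i| ≤ C := by
    rintro f g ⟨C, hf⟩ ⟨D, hg⟩
    exact ⟨⟨C + D, fun i => (abs_add_le _ _).trans (add_le_add (hf i) (hg i))⟩,
      ⟨C + D, fun i => (abs_sub _ _).trans (add_le_add (hf i) (hg i))⟩⟩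
  induction L generalizing w with
  | nil => exact le_rfl
  | cons j L ih =>
    simp only [List.map_cons, List.flatMap_cons, List.cons_append, List.nil_append]
    have h1 : signAverage (fun u : I → ℝ => ⨆ i, u i) (φ j :: L.map φ) w
        ≤ signAverage (signAverage (fun u : I → ℝ => ⨆ i, u i) [a j, b j]) (L.map φ) w := by
      -- The sign of the head becomes the innermost one, so that the one-summand comparison applies
      -- pointwise.
      rw [signAverage, ← signAverage_shift]
      refine signAverage_mono_on (P := fun w => ∃ C, ∀ i, |w i| ≤ C)
        (fun u hu => sup_add_sup_sub_le (ha j) (hb j) hu (h j)) _ ?_ w hw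
      intro x hx v hv
      obtain ⟨j', -, rfl⟩ := List.mem_map.1 hx
      exact hadd v _ hv (hφ j')
    refine h1.trans ?_
    have h2 : signAverage (fun u : I → ℝ => ⨆ i, u i) [a j, b j] = fun w =>
        (signAverage (fun u : I → ℝ => ⨆ i, u i) [b j] (w + a j) +
        signAverage (fun u : I → ℝ => ⨆ i, u i) [b j] (w - a j)) / 2 := rfl
    have h3 : signAverage (fun u : I → ℝ => ⨆ i, u i) [b j] = fun w : I → ℝ =>
        ((⨆ i, (w + b j) i) + ⨆ i, (w - b j) i) / 2 := rfl
    -- The two new signs return to the outside, which leaves four shifted starting points for the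
    -- induction hypothesis.
    rw [h2, signAverage_shift, h3, signAverage_shift, signAverage_shift]
    simp only [signAverage]
    have w1 := hadd w _ hw (ha j)
    have w2 := hadd _ _ w1.1 (hb j)
    have w3 := hadd _ _ w1.2 (hb j)
    have := ih _ w2.1
    have := ih _ w2.2
    have := ih _ w3.1
    have := ih _ w3.2
    linarith

end Contraction

/-! ### Higher moments of sign sums -/

section Normed

theorem abs_signAverage_norm_sub_le {V : Type*} [SeminormedAddCommGroup V] (L : List V) (v w : V) :
    |signAverage (fun v => ‖v‖) L v - signAverage (fun v => ‖v‖) L w| ≤ ‖v - w‖ := by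
  induction L generalizing v w with
  | nil => exact abs_norm_sub_norm_le v w
  | cons x L ih =>
    have h1 := ih (v + x) (w + x)
    have h2 := ih (v - x) (w - x)
    rw [add_sub_add_right_eq_sub] at h1
    rw [sub_sub_sub_cancel_right] at h2
    simp only [signAverage]
    rw [abs_le] at *
    constructor <;> linarith [h1.1, h1.2, h2.1, h2.2]

/-- Azuma's argument: fixing one sign changes the conditional mean of the norm by at most `2‖x‖`
between its two values, and `cosh t ≤ exp (t²/2)` absorbs each such step. -/
theorem signAverage_exp_le {V : Type*} [SeminormedAddCommGroup V] [NormedSpace ℝ V]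
    (c : ℝ) (L : List V) (v : V) :
    signAverage (fun v => Real.exp (c * ‖v‖)) L v
      ≤ Real.exp (c * signAverage (fun v => ‖v‖) L v
        + c ^ 2 * (L.map fun x => ‖x‖ ^ 2).sum / 2) := by
  induction L generalizing v with
  | nil => simp [signAverage]
  | cons x L ih =>
    have h1 := ih (v + x)
    have h2 := ih (v - x)
    simp only [signAverage, List.map_cons, List.sum_cons]
    set s := (L.map fun x => ‖x‖ ^ 2).sum
    set a := signAverage (fun v => ‖v‖) L (v + x)
    set b := signAverage (fun v => ‖v‖) L (v - x)
    have hab : |a - b| ≤ 2 * ‖x‖ := by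
      refine (abs_signAverage_norm_sub_le L _ _).trans ?_
      rw [add_sub_sub_cancel, ← two_smul ℝ x, norm_smul]
      simp
    have hab2 : (c * (a - b) / 2) ^ 2 ≤ c ^ 2 * ‖x‖ ^ 2 := by
      rw [show (c * (a - b) / 2) ^ 2 = c ^ 2 * ((a - b) / 2) ^ 2 by ring]
      gcongr ?_ * ?_
      rw [← sq_abs ((a - b) / 2), abs_div]
      gcongr
      rw [div_le_iff₀ (by norm_num)]
      norm_num
      linarith
    have hcosh := Real.cosh_le_exp_half_sq (c * (a - b) / 2)
    calc _ ≤ (Real.exp (c * a + c ^ 2 * s / 2) + Real.exp (c * b + c ^ 2 * s / 2)) / 2 := by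
          linarith
      _ = Real.exp (c * ((a + b) / 2) + c ^ 2 * s / 2) * Real.cosh (c * (a - b) / 2) := by
          rw [Real.cosh_eq, ← mul_div_assoc, mul_add, ← Real.exp_add, ← Real.exp_add]
          ring_nf
      _ ≤ Real.exp (c * ((a + b) / 2) + c ^ 2 * s / 2) *
            Real.exp ((c * (a - b) / 2) ^ 2 / 2) := by gcongr
      _ ≤ _ := by
          rw [← Real.exp_add]
          apply Real.exp_le_exp.2
          linarith

theorem signAverage_norm_rpow_le {V : Type*} [SeminormedAddCommGroup V] [NormedSpace ℝ V]
    {q : ℝ} (hq : 0 < q) (L : List V) {B : ℝ} (hB : 0 ≤ B)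
    (h1 : signAverage (fun v => ‖v‖) L 0 ≤ B) (h2 : (L.map fun x => ‖x‖ ^ 2).sum ≤ B ^ 2) :
    signAverage (fun v => ‖v‖ ^ q) L 0 ≤ q ^ q * Real.exp (3 / 2) * B ^ q := by
  -- `B` may vanish, so the bound is shown for every `C > B` and then passed to the limit.
  have main : ∀ C, B < C →
      signAverage (fun v => ‖v‖ ^ q) L 0 ≤ q ^ q * Real.exp (3 / 2) * C ^ q := by
    intro C hC
    have hC0 : 0 < C := hB.trans_lt hC
    -- This is `u ≤ exp u` at `u = ‖v‖ / (qC)`, raised to the power `q`. At rate `1/C` the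
    -- exponential moment is at most `exp (1 + 1/2)`.
    have hpt : ∀ v : V, ‖v‖ ^ q ≤ (q ^ q * C ^ q) * Real.exp (C⁻¹ * ‖v‖) := by
      intro v
      have h3 : C⁻¹ * ‖v‖ / q ≤ Real.exp (C⁻¹ * ‖v‖ / q) := by
        linarith [Real.add_one_le_exp (C⁻¹ * ‖v‖ / q)]
      have h4 := Real.rpow_le_rpow (by positivity) h3 hq.le
      rw [← Real.exp_mul, div_mul_cancel₀ _ hq.ne'] at h4
      calc ‖v‖ ^ q = (q * C * (C⁻¹ * ‖v‖ / q)) ^ q := by congr 1; field_simp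
        _ = (q ^ q * C ^ q) * (C⁻¹ * ‖v‖ / q) ^ q := by
          rw [Real.mul_rpow (by positivity) (by positivity), Real.mul_rpow hq.le hC0.le]
        _ ≤ _ := by gcongr
    refine (signAverage_mono hpt L 0).trans ?_
    rw [signAverage_const_mul, mul_right_comm]
    gcongr
    refine (signAverage_exp_le _ L 0).trans ?_
    apply Real.exp_le_exp.2
    have h5 : C⁻¹ * signAverage (fun v => ‖v‖) L 0 ≤ 1 := by
      rw [inv_mul_le_iff₀ hC0]; linarith
    have h6 : C⁻¹ ^ 2 * (L.map fun x => ‖x‖ ^ 2).sum ≤ 1 := by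
      rw [inv_pow, inv_mul_le_iff₀ (by positivity), mul_one]
      exact h2.trans (by gcongr)
    linarith
  have hcont : Continuous fun C : ℝ => q ^ q * Real.exp (3 / 2) * C ^ q :=
    continuous_const.mul (Real.continuous_rpow_const hq.le)
  exact ge_of_tendsto ((hcont.tendsto B).mono_left nhdsWithin_le_nhds)
    (Filter.eventually_of_mem (self_mem_nhdsWithin (s := Set.Ioi B)) main)

end Normed

/-! ### Rademacher type on the discrete cube -/

section RademacherType

theorem isRademacherFamily_boolSign (n : ℕ) :
    IsRademacherFamily (Measure.pi fun _ : Fin n => (PMF.uniformOfFintype Bool).toMeasure)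
      (fun j s => boolSign (s j)) where
  measurable j := (measurable_of_finite boolSign).comp (measurable_pi_apply j)
  values j s := by cases h : s j <;> simp [boolSign]
  prob_neg_one j := by
    have h : {s : Fin n → Bool | boolSign (s j) = -1} = Function.eval j ⁻¹' ({false} : Set Bool) := by
      ext s
      cases h : s j <;> simp [boolSign, h]
      norm_num
    rw [h, (measurePreserving_eval _ j).measure_preimage (by measurability)]
    simp
  prob_one j := by
    have h : {s : Fin n → Bool | boolSign (s j) = 1} = Function.eval j ⁻¹' ({true} : Set Bool) := by
      ext s
      cases h : s j <;> simp [boolSign, h]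
      norm_num
    rw [h, (measurePreserving_eval _ j).measure_preimage (by measurability)]
    simp
  indep := iIndepFun_pi (X := fun _ => boolSign) fun _ => (measurable_of_finite boolSign).aemeasurable

theorem HasRademacherTypeWith.signAverage_le {p τ : ℝ} (hp : 0 < p) (hτ : 0 ≤ τ) {F : Type*}
    [NormedAddCommGroup F] [NormedSpace ℝ F] (hF : HasRademacherTypeWith p τ F) (L : List F) :
    signAverage (fun v => ‖v‖ ^ p) L 0 ≤ τ ^ p * (L.map fun x => ‖x‖ ^ p).sum := by
  let P := Measure.pi fun _ : Fin L.length => (PMF.uniformOfFintype Bool).toMeasure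
  -- On a finite cube every set is measurable, so the completeness demanded in the definition of
  -- type is automatic.
  have : P.IsComplete := ⟨fun s _ => s.toFinite.measurableSet⟩
  have h := hF _ P L.length _ (isRademacherFamily_boolSign _) L.get
  have hint : ∫ s, ‖∑ j, boolSign (s j) • L.get j‖ ^ p ∂P
      = signAverage (fun v => ‖v‖ ^ p) L 0 := by
    conv_rhs => rw [← List.ofFn_get L]
    rw [signAverage_ofFn, integral_fintype (Integrable.of_finite), Finset.mul_sum]
    refine Finset.sum_congr rfl fun s _ => ?_
    have : P.real {s} = (2 ^ L.length : ℝ)⁻¹ := by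
      simp [P, Measure.real, Measure.pi_singleton, ENNReal.toReal_pow]
    rw [this, smul_eq_mul, zero_add]
  have hsum : ∑ j, ‖L.get j‖ ^ p = (L.map fun x => ‖x‖ ^ p).sum := by
    conv_rhs => rw [← List.ofFn_get L]
    rw [List.map_ofFn, List.sum_ofFn]
    rfl
  rw [hint, hsum] at h
  have h0 : 0 ≤ signAverage (fun v : F => ‖v‖ ^ p) L 0 :=
    (signAverage_rpow_le (fun v => by positivity) le_rfl L 0).1
  have h1 : 0 ≤ (L.map fun x => ‖x‖ ^ p).sum := by
    rw [← hsum]; positivity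
  have h2 := Real.rpow_le_rpow (by positivity) h hp.le
  rwa [Real.mul_rpow hτ (by positivity), ← Real.rpow_mul h0, ← Real.rpow_mul h1,
    one_div_mul_cancel hp.ne', Real.rpow_one, Real.rpow_one] at h2

end RademacherType

end SignAverage

/-! ### Sign sums of differences of tensor powers -/

section TensorPower

theorem abs_pow_sub_pow_le_of_abs_le_one {u w : ℝ} (hu : |u| ≤ 1) (hw : |w| ≤ 1) (k : ℕ) :
    |u ^ k - w ^ k| ≤ k * |u - w| := by
  induction k with
  | zero => simp
  | succ k ih =>
    have h1 : |u * (u ^ k - w ^ k)| ≤ k * |u - w| := by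
      rw [abs_mul]
      exact (mul_le_of_le_one_left (abs_nonneg _) hu).trans ih
    have h2 : |(u - w) * w ^ k| ≤ |u - w| := by
      rw [abs_mul, abs_pow]
      exact mul_le_of_le_one_right (abs_nonneg _) (pow_le_one₀ (abs_nonneg _) hw)
    calc |u ^ (k + 1) - w ^ (k + 1)| = |u * (u ^ k - w ^ k) + (u - w) * w ^ k| := by ring_nf
      _ ≤ _ := abs_add_le _ _
      _ ≤ _ := by push_cast; linarith

/-- A second-order difference of `t ↦ t^k`, by induction with the product rule applied twice. The
four terms add up to the step from `k²` to `(k+1)²`; the bound `δ ≤ 2` absorbs the mixed product of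
`δ` with the second-order increment. -/
theorem abs_pow_sub_pow_sub_le_of_abs_le_one {u w u' w' δ : ℝ} (hu : |u| ≤ 1) (hw : |w| ≤ 1)
    (hu' : |u'| ≤ 1) (hw' : |w'| ≤ 1) (hδ : |u' - w'| ≤ δ) (hδ2 : δ ≤ 2) (k : ℕ) :
    |(u ^ k - w ^ k) - (u' ^ k - w' ^ k)|
      ≤ k ^ 2 * (δ * |u - u'| + |(u - w) - (u' - w')|) := by
  have hδ0 : 0 ≤ δ := (abs_nonneg _).trans hδ
  have htri : |w - w'| ≤ |u - u'| + |(u - w) - (u' - w')| := by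
    have := abs_sub (u - u') ((u - w) - (u' - w'))
    rwa [show (u - u') - ((u - w) - (u' - w')) = w - w' by ring] at this
  set Δ := |u - u'|
  set Δ' := |(u - w) - (u' - w')|
  have hΔ : 0 ≤ Δ := abs_nonneg _
  have hΔ' : 0 ≤ Δ' := abs_nonneg _
  induction k with
  | zero => simp
  | succ k ih =>
    have h1 : |u * ((u ^ k - w ^ k) - (u' ^ k - w' ^ k))| ≤ k ^ 2 * (δ * Δ + Δ') := by
      rw [abs_mul]
      exact (mul_le_of_le_one_left (abs_nonneg _) hu).trans ih
    have h2 : |(u - u') * (u' ^ k - w' ^ k)| ≤ Δ * (k * δ) := by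
      rw [abs_mul]
      gcongr
      exact (abs_pow_sub_pow_le_of_abs_le_one hu' hw' k).trans (by gcongr)
    have h3 : |((u - w) - (u' - w')) * w ^ k| ≤ Δ' := by
      rw [abs_mul, abs_pow]
      exact mul_le_of_le_one_right (abs_nonneg _) (pow_le_one₀ (abs_nonneg _) hw)
    have h4 : |(u' - w') * (w ^ k - w' ^ k)| ≤ δ * (k * (Δ + Δ')) := by
      rw [abs_mul]
      gcongr
      exact (abs_pow_sub_pow_le_of_abs_le_one hw hw' k).trans (by gcongr)
    have h5 : δ * (k * Δ') ≤ 2 * (k * Δ') := by gcongr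
    have h6 : 0 ≤ δ * Δ := by positivity
    calc |(u ^ (k + 1) - w ^ (k + 1)) - (u' ^ (k + 1) - w' ^ (k + 1))|
        = |u * ((u ^ k - w ^ k) - (u' ^ k - w' ^ k)) + (u - u') * (u' ^ k - w' ^ k)
          + ((u - w) - (u' - w')) * w ^ k + (u' - w') * (w ^ k - w' ^ k)| := by ring_nf
      _ ≤ _ := abs_add_le _ _
      _ ≤ _ := add_le_add_left (abs_add_le _ _) _
      _ ≤ _ := add_le_add_left (add_le_add_left (abs_add_le _ _) _) _
      _ ≤ k ^ 2 * (δ * Δ + Δ') + Δ * (k * δ) + Δ' + δ * (k * (Δ + Δ')) := by gcongr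
      _ ≤ _ := by push_cast; nlinarith

/-- The rescaled form keeps the factor `δ / m` on `|u - u'|`. With `δ = ‖x - y‖` it later
compensates for the size of `x`, so that this term is as small as the one with `x - y`. -/
theorem abs_pow_sub_pow_sub_le {u w u' w' δ m : ℝ} (hu : |u| ≤ m) (hw : |w| ≤ m)
    (hu' : |u'| ≤ m) (hw' : |w'| ≤ m) (hδ : |u' - w'| ≤ δ) (hδ2 : δ ≤ 2 * m) {k : ℕ} (hk : 1 ≤ k) :
    |(u ^ k - w ^ k) - (u' ^ k - w' ^ k)|
      ≤ k ^ 2 * m ^ (k - 1) * (δ / m * |u - u'| + |(u - w) - (u' - w')|) := by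
  have hm : 0 ≤ m := (abs_nonneg _).trans hu
  rcases hm.eq_or_lt with rfl | hm
  · obtain rfl := abs_nonpos_iff.1 hu
    obtain rfl := abs_nonpos_iff.1 hw
    obtain rfl := abs_nonpos_iff.1 hu'
    obtain rfl := abs_nonpos_iff.1 hw'
    simp
  have hdiv : ∀ t, |t| ≤ m → |t / m| ≤ 1 := fun t ht => by
    rwa [abs_div, abs_of_pos hm, div_le_one hm]
  have h := abs_pow_sub_pow_sub_le_of_abs_le_one (δ := δ / m) (hdiv u hu) (hdiv w hw) (hdiv u' hu')
    (hdiv w' hw') (by rw [← sub_div, abs_div, abs_of_pos hm]; gcongr)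
    (by rwa [div_le_iff₀ hm]) k
  simp only [div_pow, ← sub_div, abs_div, abs_of_pos hm, abs_of_pos (pow_pos hm k)] at h
  rw [div_le_iff₀ (pow_pos hm k)] at h
  refine h.trans (le_of_eq ?_)
  obtain ⟨n, rfl⟩ := Nat.exists_eq_add_of_le' hk
  simp only [Nat.add_sub_cancel, pow_succ]
  field_simp

theorem abs_pow_sub_pow_le_mul {u w m : ℝ} (hu : |u| ≤ m) (hw : |w| ≤ m) {k : ℕ} (hk : 1 ≤ k) :
    |u ^ k - w ^ k| ≤ k * (m ^ (k - 1) * |u - w|) := by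
  have hm : 0 ≤ m := (abs_nonneg _).trans hu
  rcases hm.eq_or_lt with rfl | hm
  · obtain rfl := abs_nonpos_iff.1 hu
    obtain rfl := abs_nonpos_iff.1 hw
    simp
  have hdiv : ∀ t, |t| ≤ m → |t / m| ≤ 1 := fun t ht => by
    rwa [abs_div, abs_of_pos hm, div_le_one hm]
  have h := abs_pow_sub_pow_le_of_abs_le_one (hdiv u hu) (hdiv w hw) k
  simp only [div_pow, ← sub_div, abs_div, abs_of_pos hm, abs_of_pos (pow_pos hm k)] at h
  rw [div_le_iff₀ (pow_pos hm k)] at h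
  refine h.trans (le_of_eq ?_)
  obtain ⟨n, rfl⟩ := Nat.exists_eq_add_of_le' hk
  simp only [Nat.add_sub_cancel, pow_succ]
  field_simp

variable {E : Type*} [NormedAddCommGroup E] [NormedSpace ℝ E] {k : ℕ}

theorem evalPow_symPow (f : E →L[ℝ] ℝ) (x : E) :
    evalPow k f (SymTensor.incl k E (symPow k x)) = f x ^ k :=
  (evalPow_tprod k f fun _ => x).trans (by simp)

theorem evalPow_zero (hk : 1 ≤ k) (U : ⨂[ℝ] (_ : Fin k), E) :
    evalPow k (0 : E →L[ℝ] ℝ) U = 0 := by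
  induction U using PiTensorProduct.induction_on with
  | smul_tprod r x =>
    have : k ≠ 0 := by omega
    rw [map_smul, evalPow_tprod]
    simp [this]
  | add U V hU hV => rw [map_add, hU, hV, add_zero]

theorem abs_evalPow_le_norm (U : SymTensor k E) {f : E →L[ℝ] ℝ} (hf : ‖f‖ ≤ 1) :
    |evalPow k f (SymTensor.incl k E U)| ≤ ‖U‖ :=
  le_ciSup (evalPow_bddAbove k (SymTensor.incl k E U)) ⟨f, hf⟩

theorem SymTensor.norm_le {U : SymTensor k E} {C : ℝ}
    (h : ∀ f : E →L[ℝ] ℝ, ‖f‖ ≤ 1 → |evalPow k f (SymTensor.incl k E U)| ≤ C) : ‖U‖ ≤ C :=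
  haveI : Nonempty {f : E →L[ℝ] ℝ // ‖f‖ ≤ 1} := ⟨⟨0, by simp⟩⟩
  ciSup_le fun f => h f.1 f.2

/-- The functional `max ‖x‖ ‖y‖ ^ (k - 1) * ‖x - y‖`, which controls the distance of the `k`-fold
tensor powers of `x` and `y`. -/
def powDist (k : ℕ) (x y : E) : ℝ := max ‖x‖ ‖y‖ ^ (k - 1) * ‖x - y‖

theorem powDist_nonneg {E : Type*} [NormedAddCommGroup E] {k : ℕ} (x y : E) : 0 ≤ powDist k x y := by
  have := (norm_nonneg x).trans (le_max_left _ ‖y‖)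
  unfold powDist
  positivity

theorem norm_tensorPow_sub_le (hk : 1 ≤ k) (x y : E) :
    ‖tensorPow k x - tensorPow k y‖ ≤ k * powDist k x y := by
  unfold tensorPow powDist
  rw [← UniformSpace.Completion.coe_sub, UniformSpace.Completion.norm_coe]
  refine SymTensor.norm_le fun f hf => ?_
  have hle : ∀ z, |f z| ≤ ‖z‖ := fun z => by
    simpa using (f.le_opNorm z).trans (mul_le_of_le_one_left (norm_nonneg z) hf)
  rw [map_sub, map_sub, evalPow_symPow, evalPow_symPow]
  have hm := (norm_nonneg x).trans (le_max_left _ ‖y‖)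
  refine (abs_pow_sub_pow_le_mul ((hle x).trans (le_max_left _ _)) ((hle y).trans (le_max_right _ _))
    hk).trans ?_
  rw [← map_sub]
  gcongr
  exact hle _

theorem tensorPow_zero (hk : 1 ≤ k) : tensorPow k (0 : E) = 0 := by
  have hk' : k ≠ 0 := by omega
  unfold tensorPow
  rw [← norm_eq_zero, UniformSpace.Completion.norm_coe]
  refine le_antisymm (SymTensor.norm_le fun f _ => ?_) (norm_nonneg _)
  rw [evalPow_symPow]
  simp [hk']

theorem norm_tensorPow_le (x : E) : ‖tensorPow k x‖ ≤ ‖x‖ ^ k := by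
  unfold tensorPow
  rw [UniformSpace.Completion.norm_coe]
  refine SymTensor.norm_le fun f hf => ?_
  rw [evalPow_symPow, abs_pow]
  gcongr
  simpa using (f.le_opNorm x).trans (mul_le_of_le_one_left (norm_nonneg x) hf)

theorem continuous_tensorPow (hk : 1 ≤ k) : Continuous (tensorPow k : E → SymInjTensor k E) := by
  rw [continuous_iff_continuousAt]
  intro x
  rw [ContinuousAt, tendsto_iff_norm_sub_tendsto_zero]
  have h : Continuous fun y : E => k * powDist k y x := by
    unfold powDist
    fun_prop
  refine squeeze_zero (fun _ => norm_nonneg _) (fun y => norm_tensorPow_sub_le hk y x) ?_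
  simpa [powDist] using h.tendsto x

/-- The contraction principle needs suprema without absolute values. Since `k ≥ 1`, the functional
`f = 0` gives the value `0`, so both one-sided suprema are nonnegative and their sum dominates the
supremum of the modulus. -/
theorem norm_le_iSup_add_iSup (hk : 1 ≤ k) (U : SymTensor k E) :
    ‖U‖ ≤ (⨆ f : {f : E →L[ℝ] ℝ // ‖f‖ ≤ 1}, evalPow k f.1 (SymTensor.incl k E U))
      + ⨆ f : {f : E →L[ℝ] ℝ // ‖f‖ ≤ 1}, evalPow k f.1 (SymTensor.incl k E (-U)) := by
  have bdd : ∀ V : SymTensor k E, BddAbove (Set.range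
      fun f : {f : E →L[ℝ] ℝ // ‖f‖ ≤ 1} => evalPow k f.1 (SymTensor.incl k E V)) := by
    intro V
    refine ⟨‖V‖, ?_⟩
    rintro _ ⟨f, rfl⟩
    exact (le_abs_self _).trans (abs_evalPow_le_norm V f.2)
  have nonneg : ∀ V : SymTensor k E,
      0 ≤ ⨆ f : {f : E →L[ℝ] ℝ // ‖f‖ ≤ 1}, evalPow k f.1 (SymTensor.incl k E V) := by
    intro V
    refine le_trans (le_of_eq ?_) (le_ciSup (bdd V) ⟨0, by simp⟩)
    exact (evalPow_zero hk _).symm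
  refine SymTensor.norm_le fun f hf => ?_
  have h1 := le_ciSup (bdd U) ⟨f, hf⟩
  have h2 := le_ciSup (bdd (-U)) ⟨f, hf⟩
  have h3 := nonneg U
  have h4 := nonneg (-U)
  simp only [map_neg] at h1 h2 h3 h4 ⊢
  exact abs_le'.2 ⟨by linarith, by linarith⟩

variable (k E) in
/-- A symmetric tensor as the function `f ↦ ⟨f ⊗ ⋯ ⊗ f, U⟩` on the dual unit ball. -/
def tensorToFun : SymTensor k E →+ ({f : E →L[ℝ] ℝ // ‖f‖ ≤ 1} → ℝ) where
  toFun U f := evalPow k f.1 (SymTensor.incl k E U)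
  map_zero' := by ext f; simp
  map_add' U V := by ext f; simp

variable (E) in
/-- A vector as a function on the dual unit ball. -/
def vectorToFun : E →+ ({f : E →L[ℝ] ℝ // ‖f‖ ≤ 1} → ℝ) where
  toFun x f := f.1 x
  map_zero' := by ext f; simp
  map_add' x y := by ext f; simp

/-- This is where the nonlinear map `x ↦ ⊗ᵏx` is removed: the right side is a sign sum in `E`
itself. The outer factor `2` counts the two one-sided suprema, which have equal sign averages by
symmetry. -/
theorem signAverage_tensorPow_sub_le (hk : 1 ≤ k) {ι : Type*} (x y : ι → E) (L : List ι) :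
    signAverage (fun v => ‖v‖) (L.map fun j => tensorPow k (x j) - tensorPow k (y j)) 0
      ≤ 2 * signAverage (fun v => ‖v‖) (L.flatMap fun j =>
        [(2 * k ^ 2 * max ‖x j‖ ‖y j‖ ^ (k - 1) * (‖x j - y j‖ / max ‖x j‖ ‖y j‖)) • x j,
          (2 * k ^ 2 * max ‖x j‖ ‖y j‖ ^ (k - 1)) • (x j - y j)]) 0 := by
  have hne : Nonempty {f : E →L[ℝ] ℝ // ‖f‖ ≤ 1} := ⟨⟨0, by simp⟩⟩
  -- The factor `2` in both coefficients turns the sum of two increments into a maximum: `s + t ≤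
  -- max (2s) (2t)`.
  set A : ι → ℝ := fun j => 2 * k ^ 2 * max ‖x j‖ ‖y j‖ ^ (k - 1) *
    (‖x j - y j‖ / max ‖x j‖ ‖y j‖) with hA
  set B : ι → ℝ := fun j => 2 * k ^ 2 * max ‖x j‖ ‖y j‖ ^ (k - 1) with hB
  set u : ι → SymTensor k E := fun j => symPow k (x j) - symPow k (y j) with hu
  have hm : ∀ j, 0 ≤ max ‖x j‖ ‖y j‖ := fun j => (norm_nonneg _).trans (le_max_left _ _)
  have e1 : signAverage (fun v => ‖v‖) (L.map fun j => tensorPow k (x j) - tensorPow k (y j)) 0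
      = signAverage (fun v => ‖v‖) (L.map u) 0 := by
    have h := signAverage_map (UniformSpace.Completion.toCompl (α := SymTensor k E))
      (fun v => ‖v‖) (L.map u) 0
    simp only [UniformSpace.Completion.toCompl_apply, UniformSpace.Completion.norm_coe,
      map_zero, List.map_map] at h
    rw [← h]
    congr 1
    refine List.map_congr_left fun j _ => ?_
    simp [hu, tensorPow, UniformSpace.Completion.coe_sub]
  have e2 : signAverage (fun v => ‖v‖) (L.map u) 0 ≤
      2 * signAverage (fun V => ⨆ f, tensorToFun E k V f) (L.map u) 0 := by
    refine (signAverage_mono (norm_le_iSup_add_iSup hk) _ _).trans (le_of_eq ?_)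
    rw [signAverage_add, signAverage_neg (fun V : SymTensor k E =>
      ⨆ f : {f : E →L[ℝ] ℝ // ‖f‖ ≤ 1}, evalPow k f.1 (SymTensor.incl k E V)), neg_zero, two_mul]
    rfl
  have hle : ∀ f : {f : E →L[ℝ] ℝ // ‖f‖ ≤ 1}, ∀ z, |f.1 z| ≤ ‖z‖ := fun f z => by
    simpa using (f.1.le_opNorm z).trans (mul_le_of_le_one_left (norm_nonneg z) f.2)
  have e3 : signAverage (fun V => ⨆ f, tensorToFun E k V f) (L.map u) 0 ≤
      signAverage (fun v => ⨆ f, v f)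
        (L.flatMap fun j => [vectorToFun E (A j • x j), vectorToFun E (B j • (x j - y j))]) 0 := by
    have h := signAverage_map (tensorToFun E k) (fun v => ⨆ f, v f) (L.map u) 0
    rw [← h, List.map_map, map_zero]
    refine signAverage_iSup_le (fun j => tensorToFun E k (u j))
      (fun j => vectorToFun E (A j • x j)) (fun j => vectorToFun E (B j • (x j - y j)))
      (fun j => ⟨‖u j‖, fun f => abs_evalPow_le_norm (u j) f.2⟩) (fun j => ⟨_, fun f => hle f _⟩)
      (fun j => ⟨_, fun f => hle f _⟩) ?_ L 0 ⟨0, by simp⟩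
    intro j f g
    change |evalPow k f.1 (SymTensor.incl k E (u j)) - evalPow k g.1 (SymTensor.incl k E (u j))|
      ≤ max |f.1 (A j • x j) - g.1 (A j • x j)| |f.1 (B j • (x j - y j)) - g.1 (B j • (x j - y j))|
    simp only [hu, map_sub, evalPow_symPow, map_smul, smul_eq_mul, ← mul_sub, abs_mul]
    have hxm := le_max_left ‖x j‖ ‖y j‖
    have hym := le_max_right ‖x j‖ ‖y j‖
    refine (abs_pow_sub_pow_sub_le ((hle f _).trans hxm) ((hle f _).trans hym)
      ((hle g _).trans hxm) ((hle g _).trans hym) (δ := ‖x j - y j‖) ?_ ?_ hk).trans ?_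
    · rw [← map_sub]
      exact hle g _
    · linarith [norm_sub_le (x j) (y j)]
    have h1 : |A j| * |f.1 (x j) - g.1 (x j)| = 2 * ((k : ℝ) ^ 2 * max ‖x j‖ ‖y j‖ ^ (k - 1) *
        (‖x j - y j‖ / max ‖x j‖ ‖y j‖ * |f.1 (x j) - g.1 (x j)|)) := by
      rw [abs_of_nonneg (by have := hm j; positivity)]
      ring
    have h2 : |B j| * |f.1 (x j) - f.1 (y j) - (g.1 (x j) - g.1 (y j))| =
        2 * ((k : ℝ) ^ 2 * max ‖x j‖ ‖y j‖ ^ (k - 1) *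
          |f.1 (x j) - f.1 (y j) - (g.1 (x j) - g.1 (y j))|) := by
      rw [abs_of_nonneg (by have := hm j; positivity)]
      ring
    rw [h1, h2, mul_add]
    set s := (k : ℝ) ^ 2 * max ‖x j‖ ‖y j‖ ^ (k - 1) *
        (‖x j - y j‖ / max ‖x j‖ ‖y j‖ * |f.1 (x j) - g.1 (x j)|)
    set t := (k : ℝ) ^ 2 * max ‖x j‖ ‖y j‖ ^ (k - 1) *
          |f.1 (x j) - f.1 (y j) - (g.1 (x j) - g.1 (y j))|
    have := le_max_left (2 * s) (2 * t)
    have := le_max_right (2 * s) (2 * t)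
    linarith
  have e4 : signAverage (fun v => ⨆ f, v f)
        (L.flatMap fun j => [vectorToFun E (A j • x j), vectorToFun E (B j • (x j - y j))]) 0 ≤
      signAverage (fun v => ‖v‖) (L.flatMap fun j => [A j • x j, B j • (x j - y j)]) 0 := by
    have h := signAverage_map (vectorToFun E) (fun v => ⨆ f, v f)
      (L.flatMap fun j => [A j • x j, B j • (x j - y j)]) 0
    rw [map_zero, List.map_flatMap] at h
    refine h.le.trans (signAverage_mono (fun v => ciSup_le fun f => ?_) _ _)
    exact (le_abs_self _).trans (hle f v)
  rw [e1]
  linarith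

theorem max_pow_mul_div_mul_le {E : Type*} [NormedAddCommGroup E] {k : ℕ} (x y : E) :
    max ‖x‖ ‖y‖ ^ (k - 1) * (‖x - y‖ / max ‖x‖ ‖y‖) * ‖x‖ ≤ powDist k x y := by
  have hm := (norm_nonneg x).trans (le_max_left _ ‖y‖)
  unfold powDist
  rw [mul_assoc]
  gcongr
  rw [div_mul_eq_mul_div]
  exact div_le_of_le_mul₀ hm (norm_nonneg _) (by gcongr; exact le_max_left _ _)

theorem signAverage_tensorPow_sub_rpow_le (hk : 1 ≤ k) {p τ : ℝ} (hp : 1 ≤ p) (hτ : 0 ≤ τ)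
    (hE : HasRademacherTypeWith p τ E) {ι : Type*} (x y : ι → E) (L : List ι) :
    signAverage (fun v => ‖v‖) (L.map fun j => tensorPow k (x j) - tensorPow k (y j)) 0 ^ p
      ≤ (8 * τ * k ^ 2) ^ p * (L.map fun j => powDist k (x j) (y j) ^ p).sum := by
  have hp0 : 0 < p := by linarith
  have h1 := signAverage_tensorPow_sub_le hk x y L
  have h2 : ∀ L : List E, 0 ≤ signAverage (fun v => ‖v‖) L 0 := fun L =>
    (signAverage_rpow_le (fun v => norm_nonneg v) hp L 0).1
  refine (Real.rpow_le_rpow (signAverage_rpow_le (fun v => norm_nonneg v) hp _ 0).1 h1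
    hp0.le).trans ?_
  rw [Real.mul_rpow (by norm_num) (h2 _)]
  refine (mul_le_mul_of_nonneg_left ((signAverage_rpow_le (fun v => norm_nonneg v) hp _ 0).2.trans
    (hE.signAverage_le hp0 hτ _)) (by positivity)).trans ?_
  rw [← mul_assoc, ← Real.mul_rpow (by norm_num) hτ, List.map_flatMap]
  have h3 : (L.flatMap fun j => List.map (fun x => ‖x‖ ^ p)
      [(2 * k ^ 2 * max ‖x j‖ ‖y j‖ ^ (k - 1) * (‖x j - y j‖ / max ‖x j‖ ‖y j‖)) • x j,
          (2 * k ^ 2 * max ‖x j‖ ‖y j‖ ^ (k - 1)) • (x j - y j)]).sum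
      ≤ (4 * k ^ 2 : ℝ) ^ p * (L.map fun j => powDist k (x j) (y j) ^ p).sum := by
    induction L with
    | nil => simp
    | cons j L ih =>
      simp only [List.flatMap_cons, List.sum_append, List.map_cons, List.sum_cons, List.map_nil,
        List.sum_nil, mul_add]
      refine add_le_add ?_ (ih (signAverage_tensorPow_sub_le hk x y L))
      have hd := powDist_nonneg (k := k) (x j) (y j)
      have hm := (norm_nonneg (x j)).trans (le_max_left _ ‖y j‖)
      have h4 : ‖(2 * k ^ 2 * max ‖x j‖ ‖y j‖ ^ (k - 1) *
          (‖x j - y j‖ / max ‖x j‖ ‖y j‖)) • x j‖ ≤ 2 * k ^ 2 * powDist k (x j) (y j) := by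
        rw [norm_smul, Real.norm_of_nonneg (by positivity), mul_assoc (2 * (k : ℝ) ^ 2), mul_assoc]
        gcongr
        exact max_pow_mul_div_mul_le _ _
      have h5 : ‖(2 * k ^ 2 * max ‖x j‖ ‖y j‖ ^ (k - 1)) • (x j - y j)‖
          ≤ 2 * k ^ 2 * powDist k (x j) (y j) := by
        rw [norm_smul, Real.norm_of_nonneg (by positivity), mul_assoc (2 * (k : ℝ) ^ 2)]
        rfl
      have h6 := Real.rpow_le_rpow (norm_nonneg _) h4 hp0.le
      have h7 := Real.rpow_le_rpow (norm_nonneg _) h5 hp0.le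
      -- Each `j` contributes two vectors of norm at most `2k² · powDist`; absorbing this count into
      -- the `p`-th power gives `4k²`, hence `8τk²` in total.
      have h8 : (2 : ℝ) ≤ 2 ^ p := by
        simpa using Real.rpow_le_rpow_of_exponent_le (x := 2) (by norm_num) hp
      calc _ ≤ 2 * (2 * k ^ 2 * powDist k (x j) (y j)) ^ p := by linarith
        _ ≤ 2 ^ p * (2 * k ^ 2 * powDist k (x j) (y j)) ^ p := by gcongr
        _ = _ := by
          rw [← Real.mul_rpow (by norm_num) (by positivity),
            ← Real.mul_rpow (by positivity) (by positivity)]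
          ring_nf
  refine (mul_le_mul_of_nonneg_left h3 (by positivity)).trans (le_of_eq ?_)
  rw [← mul_assoc, ← Real.mul_rpow (by positivity) (by positivity)]
  ring_nf

theorem List.sum_rpow_le_rpow_sum {ι : Type*} {a : ι → ℝ} (ha : ∀ j, 0 ≤ a j) {p r : ℝ}
    (hp : 0 < p) (hr : p ≤ r) (L : List ι) :
    (L.map fun j => a j ^ r).sum ≤ (L.map fun j => a j ^ p).sum ^ (r / p) := by
  have hnn : ∀ L : List ι, 0 ≤ (L.map fun j => a j ^ p).sum := fun L =>
    List.sum_nonneg (by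
      simp only [List.mem_map, forall_exists_index, and_imp, forall_apply_eq_imp_iff₂]
      exact fun j _ => Real.rpow_nonneg (ha j) p)
  induction L with
  | nil => simpa using Real.rpow_nonneg le_rfl _
  | cons j L ih =>
    simp only [List.map_cons, List.sum_cons]
    have h0 := Real.rpow_nonneg (ha j) p
    have h := Real.add_rpow_le_rpow_add h0 (hnn L) ((one_le_div hp).2 hr)
    rw [← Real.rpow_mul (ha j), mul_div_cancel₀ _ hp.ne'] at h
    linarith

/-- The constant in the moment inequality for sign averages of differences of tensor powers. -/
def momentConst (k : ℕ) (q τ : ℝ) : ℝ :=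
  q ^ q * Real.exp (3 / 2) * ((8 * τ + 1) * k ^ 2) ^ q

theorem momentConst_nonneg (k : ℕ) {q τ : ℝ} (hq : 0 ≤ q) (hτ : 0 ≤ τ) : 0 ≤ momentConst k q τ := by
  unfold momentConst
  positivity

theorem signAverage_norm_rpow_tensorPow_sub_le (hk : 1 ≤ k) {p q τ : ℝ} (hp : 1 ≤ p) (hp2 : p ≤ 2)
    (hq : 0 < q) (hτ : 0 ≤ τ) (hE : HasRademacherTypeWith p τ E) {ι : Type*} (x y : ι → E)
    (L : List ι) :
    signAverage (fun v => ‖v‖ ^ q) (L.map fun j => tensorPow k (x j) - tensorPow k (y j)) 0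
      ≤ momentConst k q τ * (L.map fun j => powDist k (x j) (y j) ^ p).sum ^ (q / p) := by
  have hp0 : 0 < p := by linarith
  set S := (L.map fun j => powDist k (x j) (y j) ^ p).sum with hS
  have hS0 : 0 ≤ S := List.sum_nonneg (by
      simp only [List.mem_map, forall_exists_index, and_imp, forall_apply_eq_imp_iff₂]
      exact fun j _ => Real.rpow_nonneg (powDist_nonneg _ _) p)
  have hk1 : (1 : ℝ) ≤ k := by exact_mod_cast hk
  have h0 := (signAverage_rpow_le (fun v => norm_nonneg v) hp
    (L.map fun j => tensorPow k (x j) - tensorPow k (y j)) 0).1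
  -- This `B` must dominate both the mean, of order `8τk² S^(1/p)`, and the `ℓ₂` norm of the
  -- summands. The latter is at most `k S^(1/p)` because `p ≤ 2`; hence the `+ 1`.
  have h := signAverage_norm_rpow_le hq (L.map fun j => tensorPow k (x j) - tensorPow k (y j))
    (B := (8 * τ + 1) * k ^ 2 * S ^ (1 / p)) (by positivity) ?_ ?_
  · refine h.trans (le_of_eq ?_)
    rw [Real.mul_rpow (by positivity) (by positivity), ← Real.rpow_mul hS0, momentConst,
      mul_assoc, mul_assoc, mul_assoc, one_div_mul_eq_div]
  · have h1 := Real.rpow_le_rpow (by positivity)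
      (signAverage_tensorPow_sub_rpow_le hk hp hτ hE x y L) (by positivity : 0 ≤ 1 / p)
    rw [Real.mul_rpow (by positivity) hS0, ← Real.rpow_mul h0, ← Real.rpow_mul (by positivity),
      mul_one_div_cancel hp0.ne', Real.rpow_one, Real.rpow_one] at h1
    refine h1.trans ?_
    gcongr
    linarith
  · have h1 : (L.map fun j => powDist k (x j) (y j) ^ (2 : ℝ)).sum ≤ S ^ (2 / p) :=
      List.sum_rpow_le_rpow_sum (fun j => powDist_nonneg _ _) hp0 hp2 L
    have h2 : ((L.map fun j => tensorPow k (x j) - tensorPow k (y j)).map fun v => ‖v‖ ^ 2).sum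
        ≤ (k : ℝ) ^ 2 * (L.map fun j => powDist k (x j) (y j) ^ (2 : ℝ)).sum := by
      rw [← List.sum_map_mul_left, List.map_map]
      refine List.sum_le_sum fun j _ => ?_
      simp only [Function.comp_apply, Real.rpow_two]
      rw [← mul_pow]
      gcongr
      exact norm_tensorPow_sub_le hk _ _
    rw [mul_pow, ← Real.rpow_natCast (S ^ (1 / p)), ← Real.rpow_mul hS0]
    push_cast
    rw [one_div_mul_eq_div]
    refine (h2.trans (mul_le_mul_of_nonneg_left h1 (by positivity))).trans ?_
    gcongr
    nlinarith [mul_nonneg hτ (sq_nonneg (k : ℝ))]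

theorem sum_norm_rpow_tensorPow_sub_le (hk : 1 ≤ k) {p q τ : ℝ} (hp : 1 ≤ p) (hp2 : p ≤ 2)
    (hq : p ≤ q) (hτ : 0 ≤ τ) (hE : HasRademacherTypeWith p τ E) {n : ℕ} (x y : Fin n → E) :
    (2 ^ n : ℝ)⁻¹ * ∑ s : Fin n → Bool,
        ‖∑ j, boolSign (s j) • (tensorPow k (x j) - tensorPow k (y j))‖ ^ q
      ≤ momentConst k q τ * (n ^ (q / p - 1) * ∑ j, powDist k (x j) (y j) ^ q) := by
  have hp0 : 0 < p := by linarith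
  have h := signAverage_norm_rpow_tensorPow_sub_le hk hp hp2 (hp0.trans_le hq) hτ hE x y
    (List.ofFn id)
  rw [List.map_ofFn, List.map_ofFn, signAverage_ofFn, List.sum_ofFn] at h
  simp only [zero_add, Function.comp_apply, id] at h
  refine h.trans ?_
  gcongr
  · exact momentConst_nonneg k (hp0.trans_le hq).le hτ
  have h1 := Real.rpow_sum_le_const_mul_sum_rpow_of_nonneg Finset.univ
    (f := fun j => powDist k (x j) (y j) ^ p) ((one_le_div hp0).2 hq)
    (fun j _ => Real.rpow_nonneg (powDist_nonneg _ _) p)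
  simpa only [← Real.rpow_mul (powDist_nonneg _ _), mul_div_cancel₀ _ hp0.ne', Finset.card_univ,
    Fintype.card_fin] using h1

end TensorPower

/-! ### Symmetrization by an independent copy -/

section Symmetrization

variable {Ω : Type*} [MeasurableSpace Ω] {μ : Measure Ω} [IsProbabilityMeasure μ]
  {T : Type*} [NormedAddCommGroup T] [NormedSpace ℝ T]

theorem lintegral_enorm_rpow_eq_eLpNorm_rpow {α T : Type*} [MeasurableSpace α] {m : Measure α}
    [NormedAddCommGroup T] {q : ℝ} (hq : 0 < q) (f : α → T) :
    ∫⁻ a, ‖f a‖ₑ ^ q ∂m = eLpNorm f (ENNReal.ofReal q) m ^ q := by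
  rw [eLpNorm_eq_lintegral_rpow_enorm_toReal (by simpa using hq) ENNReal.ofReal_ne_top,
    ENNReal.toReal_ofReal hq.le, ← ENNReal.rpow_mul, one_div_mul_cancel hq.ne', ENNReal.rpow_one]

theorem eLpNorm_integral_right_le {α β : Type*} [MeasurableSpace α] [MeasurableSpace β]
    {m : Measure α} {m' : Measure β} [SFinite m] [IsProbabilityMeasure m'] {q : ℝ} (hq : 1 ≤ q)
    {F : α × β → T} (hF : AEStronglyMeasurable F (m.prod m')) :
    eLpNorm (fun a => ∫ b, F (a, b) ∂m') (ENNReal.ofReal q) m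
      ≤ eLpNorm F (ENNReal.ofReal q) (m.prod m') := by
  have hq0 : 0 < q := by linarith
  rw [← ENNReal.rpow_le_rpow_iff hq0, ← lintegral_enorm_rpow_eq_eLpNorm_rpow hq0,
    ← lintegral_enorm_rpow_eq_eLpNorm_rpow hq0, lintegral_prod _ (hF.enorm.pow_const q)]
  refine lintegral_mono_ae ?_
  filter_upwards [hF.prodMk_left] with a ha
  rw [lintegral_enorm_rpow_eq_eLpNorm_rpow hq0 fun b => F (a, b)]
  gcongr
  refine (enorm_integral_le_lintegral_enorm _).trans ?_
  rw [← eLpNorm_one_eq_lintegral_enorm]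
  exact eLpNorm_le_eLpNorm_of_exponent_le (by simpa using hq) ha

variable [CompleteSpace T] {D : Ω → T} {n : ℕ}

/-- The mean is an integral over an independent copy, so by Jensen the centred sum is dominated by a
sum of differences of copies. Exchanging a pair flips the sign of its difference and preserves the
law; hence any fixed `s` is allowed, and the triangle inequality costs the factor `2`. -/
theorem eLpNorm_sum_sub_integral_le {q : ℝ} (hq : 1 ≤ q) (hD : Integrable D μ)
    (s : Fin n → Bool) :
    eLpNorm (fun ω : Fin n → Ω => ∑ j, (D (ω j) - ∫ x, D x ∂μ)) (ENNReal.ofReal q)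
        (Measure.pi fun _ => μ)
      ≤ 2 * eLpNorm (fun ω : Fin n → Ω => ∑ j, boolSign (s j) • D (ω j)) (ENNReal.ofReal q)
        (Measure.pi fun _ => μ) := by
  set ν : Measure (Fin n → Ω) := Measure.pi fun _ => μ with hν
  set ρ : Measure (Fin n → Ω × Ω) := Measure.pi fun _ => μ.prod μ with hρ
  have heval : ∀ j, MeasurePreserving (Function.eval j) ν μ := fun j => measurePreserving_eval _ j
  have hint : ∀ j, Integrable (fun ω : Fin n → Ω => D (ω j)) ν := fun j =>
    (heval j).integrable_comp_of_integrable hD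
  have hq1 : 1 ≤ ENNReal.ofReal q := by simpa using hq
  set F : (Fin n → Ω) × (Fin n → Ω) → T := fun w => ∑ j, (D (w.1 j) - D (w.2 j)) with hF
  set H : (Fin n → Ω) → T := fun ω => ∑ j, boolSign (s j) • D (ω j) with hH
  have hHm : AEStronglyMeasurable H ν :=
    Finset.aestronglyMeasurable_fun_sum _ fun j _ => (hint j).1.const_smul _
  have hFm : AEStronglyMeasurable F (ν.prod ν) :=
    Finset.aestronglyMeasurable_fun_sum _ fun j _ => (hint j).1.comp_fst.sub (hint j).1.comp_snd
  have e1 : (fun ω : Fin n → Ω => ∑ j, (D (ω j) - ∫ x, D x ∂μ))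
      = fun ω => ∫ ω', F (ω, ω') ∂ν := by
    ext ω
    simp only [hF]
    rw [integral_finsetSum _ fun j _ => by
      exact (integrable_const (D (ω j))).sub (hint j)]
    refine Finset.sum_congr rfl fun j _ => ?_
    rw [integral_sub (integrable_const _) (hint j), integral_const, probReal_univ, one_smul,
      integral_comp_eval (i := j) hD.1]
  have harrow := measurePreserving_arrowProdEquivProdArrow Ω Ω (Fin n) (fun _ => μ) fun _ => μ
  have hswap : MeasurePreserving
      (fun (w : Fin n → Ω × Ω) j => (if s j then id else Prod.swap) (w j)) ρ ρ := by
    refine measurePreserving_pi _ _ fun j => ?_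
    cases s j
    · exact Measure.measurePreserving_swap
    · exact MeasurePreserving.id _
  have hfst : MeasurePreserving (fun (w : Fin n → Ω × Ω) j => (w j).1) ρ ν :=
    measurePreserving_pi _ _ fun j => measurePreserving_fst
  have hsnd : MeasurePreserving (fun (w : Fin n → Ω × Ω) j => (w j).2) ρ ν :=
    measurePreserving_pi _ _ fun j => measurePreserving_snd
  have hFm' := hFm.comp_measurePreserving harrow
  rw [e1]
  refine (eLpNorm_integral_right_le hq hFm).trans ?_
  rw [← eLpNorm_comp_measurePreserving hFm harrow, ← eLpNorm_comp_measurePreserving hFm' hswap]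
  have e2 : (F ∘ MeasurableEquiv.arrowProdEquivProdArrow Ω Ω (Fin n)) ∘
      (fun (w : Fin n → Ω × Ω) j => (if s j then id else Prod.swap) (w j))
      = H ∘ (fun (w : Fin n → Ω × Ω) j => (w j).1) - H ∘ fun (w : Fin n → Ω × Ω) j => (w j).2 := by
    ext w
    simp only [Function.comp_apply, hF, hH, Pi.sub_apply, ← Finset.sum_sub_distrib]
    refine Finset.sum_congr rfl fun j _ => ?_
    cases h : s j <;> simp [MeasurableEquiv.arrowProdEquivProdArrow, Equiv.arrowProdEquivProdArrow,
      boolSign, h]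
    abel
  rw [e2]
  refine (eLpNorm_sub_le (hHm.comp_measurePreserving hfst) (hHm.comp_measurePreserving hsnd)
    hq1).trans ?_
  rw [eLpNorm_comp_measurePreserving hHm hfst, eLpNorm_comp_measurePreserving hHm hsnd, two_mul]

end Symmetrization

/-! ### From independent copies to coordinates -/

section Transfer

variable {Ω : Type*} [MeasurableSpace Ω] {μ : Measure Ω} [IsProbabilityMeasure μ]
  {T : Type*} [NormedAddCommGroup T] [MeasurableSpace T] [BorelSpace T]

/-- The sum of independent copies of `D` has the same norm as the sum of the coordinate copies on
the product space. The space `T` need not be separable. -/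
theorem eLpNorm_sum_sub_eq_pi {D : Ω → T} (hD : AEStronglyMeasurable D μ) {n : ℕ}
    {ξ : Fin n → Ω → T} (hξ : ∀ j, IdentDistrib (ξ j) D μ μ) (hind : iIndepFun ξ μ) (c : T)
    (q : ℝ≥0∞) :
    eLpNorm (fun ω => ∑ j, (ξ j ω - c)) q μ
      = eLpNorm (fun ω : Fin n → Ω => ∑ j, (D (ω j) - c)) q (Measure.pi fun _ => μ) := by
  classical
  -- Without separability, addition need not be measurable for the product of Borel σ-algebras.
  -- Almost all values lie in the closed separable set `S`, and retracting onto `S` makes the sum a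
  -- strongly measurable function `Ψ` of the coordinates.
  obtain ⟨t, ht, htD⟩ := hD.isSeparable_ae_range
  set S := closure t with hS
  have hSm : MeasurableSet S := isClosed_closure.measurableSet
  have hSD : ∀ᵐ ω ∂μ, D ω ∈ S := htD.mono fun _ h => subset_closure h
  have hSξ : ∀ j, ∀ᵐ ω ∂μ, ξ j ω ∈ S := fun j => (hξ j).symm.ae_mem_snd hSm hSD
  obtain ⟨ω₀, hω₀⟩ := hSD.exists
  have : SecondCountableTopology S := by
    have := ht.closure.separableSpace
    exact UniformSpace.secondCountable_of_separable S
  set g : T → S := fun x => if h : x ∈ S then ⟨x, h⟩ else ⟨D ω₀, hω₀⟩ with hg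
  have hgm : Measurable g := Measurable.dite measurable_id measurable_const hSm
  have hgS : ∀ x ∈ S, (g x : T) = x := fun x hx => by simp [hg, hx]
  set Ψ : (Fin n → T) → T := fun u => ∑ j, ((g (u j) : T) - c) with hΨ
  have hΨm : StronglyMeasurable Ψ := by
    have h1 : Continuous fun u : Fin n → S => ∑ j, ((u j : T) - c) := by fun_prop
    have h2 : Measurable fun (u : Fin n → T) j => g (u j) :=
      measurable_pi_lambda _ fun j => hgm.comp (measurable_pi_apply j)
    exact h1.stronglyMeasurable.comp_measurable h2
  have hξm : AEMeasurable (fun ω j => ξ j ω) μ :=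
    aemeasurable_pi_lambda _ fun j => (hξ j).aemeasurable_fst
  have heval : ∀ j, MeasurePreserving (Function.eval j) (Measure.pi fun _ : Fin n => μ) μ :=
    fun j => measurePreserving_eval _ j
  have hDm : AEMeasurable (fun (ω : Fin n → Ω) j => D (ω j)) (Measure.pi fun _ => μ) :=
    aemeasurable_pi_lambda _ fun j =>
      hD.aemeasurable.comp_quasiMeasurePreserving (heval j).quasiMeasurePreserving
  have hlaw : μ.map (fun ω j => ξ j ω)
      = (Measure.pi fun _ : Fin n => μ).map fun ω j => D (ω j) := by
    have : IsProbabilityMeasure (μ.map D) := Measure.isProbabilityMeasure_map hD.aemeasurable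
    rw [(iIndepFun_iff_map_fun_eq_pi_map fun j => (hξ j).aemeasurable_fst).1 hind,
      Measure.pi_map_pi (f := fun _ => D) fun _ => hD.aemeasurable]
    congr 1
    ext1 j
    exact (hξ j).map_eq
  have e1 : (fun ω => ∑ j, (ξ j ω - c)) =ᵐ[μ] Ψ ∘ fun ω j => ξ j ω := by
    filter_upwards [ae_all_iff.2 hSξ] with ω hω
    exact Finset.sum_congr rfl fun j _ => by rw [hgS _ (hω j)]
  have e2 : (fun ω : Fin n → Ω => ∑ j, (D (ω j) - c)) =ᵐ[Measure.pi fun _ => μ]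
      Ψ ∘ fun ω j => D (ω j) := by
    filter_upwards [ae_all_iff.2 fun j => (heval j).quasiMeasurePreserving.ae hSD] with ω hω
    exact Finset.sum_congr rfl fun j _ => by rw [hgS _ (hω j)]
  rw [eLpNorm_congr_ae e1, eLpNorm_congr_ae e2,
    ← eLpNorm_map_measure hΨm.aestronglyMeasurable hξm, hlaw,
    eLpNorm_map_measure hΨm.aestronglyMeasurable hDm]

end Transfer

/-! ### Sampling error on a single level -/

section MonteCarlo

variable {E : Type*} [NormedAddCommGroup E] [NormedSpace ℝ E] {k : ℕ}
  {Ω : Type*} [MeasurableSpace Ω] {μ : Measure Ω} [IsProbabilityMeasure μ]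

theorem continuous_powDist {E : Type*} [NormedAddCommGroup E] {k : ℕ} :
    Continuous fun z : E × E => powDist k z.1 z.2 := by
  unfold powDist
  fun_prop

/-- Hölder with weights `(k-1)/k` and `1/k`, after bounding the maximum of the norms by their sum;
this is what calls for integrability of order `kq`. -/
theorem eLpNorm_powDist_le {E : Type*} [NormedAddCommGroup E] {k : ℕ} {Ω : Type*}
    [MeasurableSpace Ω] {μ : Measure Ω} (hk : 1 ≤ k) {q : ℝ} (hq : 1 ≤ q) {X Y : Ω → E}
    (hX : AEStronglyMeasurable X μ) (hY : AEStronglyMeasurable Y μ) {S R : ℝ≥0∞}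
    (hXS : eLpNorm X (ENNReal.ofReal (k * q)) μ ≤ S)
    (hYS : eLpNorm Y (ENNReal.ofReal (k * q)) μ ≤ S)
    (hXY : eLpNorm (fun ω => X ω - Y ω) (ENNReal.ofReal (k * q)) μ ≤ R) :
    eLpNorm (fun ω => powDist k (X ω) (Y ω)) (ENNReal.ofReal q) μ ≤ (2 * S) ^ (k - 1) * R := by
  have hq0 : 0 < q := by linarith
  have hk0 : (0 : ℝ) < k := by exact_mod_cast hk
  have hk1 : (1 : ℝ) ≤ k := by exact_mod_cast hk
  have hkq : 0 < k * q := by positivity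
  have hkq1 : 1 ≤ ENNReal.ofReal (k * q) := by
    rw [ENNReal.one_le_ofReal]
    nlinarith
  set f : Ω → ℝ := fun ω => ‖X ω‖ + ‖Y ω‖ with hf
  have hfm : AEStronglyMeasurable f μ := hX.norm.add hY.norm
  have hfS : eLpNorm f (ENNReal.ofReal (k * q)) μ ≤ 2 * S := by
    refine (eLpNorm_add_le hX.norm hY.norm hkq1).trans ?_
    rw [eLpNorm_norm, eLpNorm_norm, two_mul]
    exact add_le_add hXS hYS
  have hpt : ∀ ω, ‖powDist k (X ω) (Y ω)‖ₑ ^ q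
      ≤ (‖f ω‖ₑ ^ (k * q)) ^ ((k - 1) / k : ℝ) * (‖X ω - Y ω‖ₑ ^ (k * q)) ^ (1 / k : ℝ) := by
    intro ω
    rw [← ENNReal.rpow_mul, ← ENNReal.rpow_mul,
      show k * q * ((k - 1) / k) = (k - 1 : ℕ) * q by push_cast [Nat.cast_sub hk]; field_simp,
      show k * q * (1 / k) = q by field_simp, ENNReal.rpow_mul, ENNReal.rpow_natCast,
      ← ENNReal.mul_rpow_of_nonneg _ _ hq0.le]
    gcongr
    rw [powDist, enorm_mul, enorm_pow, enorm_norm]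
    gcongr
    rw [enorm_le_iff_norm_le, Real.norm_of_nonneg ((norm_nonneg _).trans (le_max_left _ _)),
      Real.norm_of_nonneg (by positivity)]
    exact max_le (by simp [hf]) (by simp [hf])
  rw [← ENNReal.rpow_le_rpow_iff hq0, ← lintegral_enorm_rpow_eq_eLpNorm_rpow hq0]
  refine (lintegral_mono hpt).trans ?_
  refine (ENNReal.lintegral_mul_norm_pow_le (hfm.enorm.pow_const _)
    ((hX.sub hY).enorm.pow_const _) (by have := sub_nonneg.2 hk1; positivity) (by positivity)
    (by field_simp; ring)).trans ?_
  have e2 : ∫⁻ ω, ‖X ω - Y ω‖ₑ ^ (k * q) ∂μ =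
    eLpNorm (fun ω => X ω - Y ω) (ENNReal.ofReal (k * q)) μ ^ (k * q) :=
    lintegral_enorm_rpow_eq_eLpNorm_rpow hkq _
  rw [lintegral_enorm_rpow_eq_eLpNorm_rpow hkq]
  erw [e2]
  rw [← ENNReal.rpow_mul, ← ENNReal.rpow_mul,
      show k * q * ((k - 1) / k) = (k - 1 : ℕ) * q by push_cast [Nat.cast_sub hk]; field_simp,
      show k * q * (1 / k) = q by field_simp, ENNReal.rpow_mul, ENNReal.rpow_natCast,
      ← ENNReal.mul_rpow_of_nonneg _ _ hq0.le]
  gcongr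

theorem memLp_tensorPow {Ω : Type*} [MeasurableSpace Ω] {μ : Measure Ω} (hk : 1 ≤ k) {q : ℝ} (hq : 0 < q) {X : Ω → E}
    (hX : MemLp X (ENNReal.ofReal (k * q)) μ) :
    MemLp (fun ω => tensorPow k (X ω)) (ENNReal.ofReal q) μ := by
  have hk0 : (0 : ℝ) < k := by exact_mod_cast hk
  refine ⟨(continuous_tensorPow hk).comp_aestronglyMeasurable hX.1, ?_⟩
  rw [← ENNReal.rpow_lt_top_iff_of_pos hq, ← lintegral_enorm_rpow_eq_eLpNorm_rpow hq]
  have hkq : 0 < k * q := by positivity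
  have h := (ENNReal.rpow_lt_top_iff_of_pos hkq).2 hX.2
  rw [← lintegral_enorm_rpow_eq_eLpNorm_rpow hkq] at h
  refine lt_of_le_of_lt (lintegral_mono fun ω => ?_) h
  rw [ENNReal.rpow_mul, ENNReal.rpow_natCast, ← enorm_norm (X ω), ← enorm_pow]
  gcongr
  rw [enorm_le_iff_norm_le, norm_pow, norm_norm]
  exact norm_tensorPow_le _

theorem eLpNorm_sum_tensorPow_sub_le (hk : 1 ≤ k) {p q τ : ℝ} (hp : 1 ≤ p) (hp2 : p ≤ 2)
    (hq : p ≤ q) (hτ : 0 ≤ τ) (hE : HasRademacherTypeWith p τ E) {X Y : Ω → E}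
    (hX : AEStronglyMeasurable X μ) (hY : AEStronglyMeasurable Y μ)
    (hD : Integrable (fun ω => tensorPow k (X ω) - tensorPow k (Y ω)) μ) (n : ℕ) :
    eLpNorm (fun ω : Fin n → Ω => ∑ j, (tensorPow k (X (ω j)) - tensorPow k (Y (ω j))
        - ∫ x, (tensorPow k (X x) - tensorPow k (Y x)) ∂μ)) (ENNReal.ofReal q)
        (Measure.pi fun _ => μ)
      ≤ ENNReal.ofReal (2 * momentConst k q τ ^ (1 / q) * n ^ (1 / p))
        * eLpNorm (fun ω => powDist k (X ω) (Y ω)) (ENNReal.ofReal q) μ := by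
  have hq1 : 1 ≤ q := hp.trans hq
  have hq0 : 0 < q := by linarith
  have hp0 : 0 < p := by linarith
  set ν : Measure (Fin n → Ω) := Measure.pi fun _ => μ with hν
  have heval : ∀ j, MeasurePreserving (Function.eval j) ν μ := fun j => measurePreserving_eval _ j
  set D : Ω → SymInjTensor k E := fun ω => tensorPow k (X ω) - tensorPow k (Y ω) with hDdef
  set a : Ω → ℝ := fun ω => powDist k (X ω) (Y ω) with ha
  have ham : AEStronglyMeasurable a μ := continuous_powDist.comp_aestronglyMeasurable (hX.prodMk hY)
  have hDj : ∀ j, AEStronglyMeasurable (fun ω : Fin n → Ω => D (ω j)) ν := fun j =>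
    hD.1.comp_measurePreserving (heval j)
  have hHm : ∀ s : Fin n → Bool, AEStronglyMeasurable
      (fun ω : Fin n → Ω => ∑ j, boolSign (s j) • D (ω j)) ν := fun s =>
    Finset.aestronglyMeasurable_fun_sum _ fun j _ => by exact (hDj j).const_smul (boolSign (s j))
  have haj : ∀ j, ∫⁻ ω : Fin n → Ω, ‖a (ω j)‖ₑ ^ q ∂ν = eLpNorm a (ENNReal.ofReal q) μ ^ q := by
    intro j
    rw [← eLpNorm_comp_measurePreserving ham (heval j), ← lintegral_enorm_rpow_eq_eLpNorm_rpow hq0]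
    rfl
  set A := eLpNorm (fun ω : Fin n → Ω => ∑ j, (D (ω j) - ∫ x, D x ∂μ)) (ENNReal.ofReal q) ν with hA
  have h1 : ∀ s : Fin n → Bool,
      A ^ q ≤ 2 ^ q * ∫⁻ ω, ‖∑ j, boolSign (s j) • D (ω j)‖ₑ ^ q ∂ν := by
    intro s
    rw [lintegral_enorm_rpow_eq_eLpNorm_rpow hq0 fun ω : Fin n → Ω => ∑ j, boolSign (s j) • D (ω j),
      ← ENNReal.mul_rpow_of_nonneg _ _ hq0.le]
    gcongr
    exact eLpNorm_sum_sub_integral_le hq1 hD s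
  -- The left side does not depend on the signs, so the bounds for fixed `s` may be averaged. The
  -- average moves under the integral, where the deterministic moment inequality applies at each
  -- `ω`.
  have h2 : A ^ q ≤ 2 ^ q * ∫⁻ ω, (2 ^ n : ℝ≥0∞)⁻¹ *
      ∑ s : Fin n → Bool, ‖∑ j, boolSign (s j) • D (ω j)‖ₑ ^ q ∂ν := by
    rw [lintegral_const_mul' _ _ (by simp),
      lintegral_finsetSum' _ fun s _ => (hHm s).enorm.pow_const q, ← mul_assoc,
      mul_comm (2 ^ q : ℝ≥0∞), mul_assoc, Finset.mul_sum]
    calc A ^ q = (2 ^ n : ℝ≥0∞)⁻¹ * ∑ s : Fin n → Bool, A ^ q := by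
          simp only [Finset.sum_const, Finset.card_univ, Fintype.card_pi, Fintype.card_bool,
            Finset.prod_const, Fintype.card_fin, nsmul_eq_mul]
          push_cast
          rw [← mul_assoc, ENNReal.inv_mul_cancel (by simp) (by simp), one_mul]
      _ ≤ _ := by gcongr with s; exact h1 s
  have h3 : ∀ ω : Fin n → Ω, (2 ^ n : ℝ≥0∞)⁻¹ *
      ∑ s : Fin n → Bool, ‖∑ j, boolSign (s j) • D (ω j)‖ₑ ^ q
      ≤ ENNReal.ofReal (momentConst k q τ * n ^ (q / p - 1)) * ∑ j, ‖a (ω j)‖ₑ ^ q := by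
    intro ω
    have h := ENNReal.ofReal_le_ofReal (sum_norm_rpow_tensorPow_sub_le hk hp hp2 hq hτ hE
      (fun j => X (ω j)) fun j => Y (ω j))
    rw [← mul_assoc, ENNReal.ofReal_mul (by positivity), ENNReal.ofReal_mul
      (mul_nonneg (momentConst_nonneg k hq0.le hτ) (by positivity)),
      ENNReal.ofReal_sum_of_nonneg fun s _ => by positivity,
      ENNReal.ofReal_sum_of_nonneg fun j _ => Real.rpow_nonneg (powDist_nonneg _ _) _,
      ENNReal.ofReal_inv_of_pos (by positivity), ENNReal.ofReal_pow (by norm_num)] at h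
    simp only [← ENNReal.ofReal_rpow_of_nonneg (norm_nonneg _) hq0.le, ofReal_norm,
      ← ENNReal.ofReal_rpow_of_nonneg (powDist_nonneg _ _) hq0.le, ENNReal.ofReal_ofNat] at h
    refine h.trans (le_of_eq ?_)
    congr 1
    refine Finset.sum_congr rfl fun j _ => ?_
    rw [Real.enorm_of_nonneg (powDist_nonneg _ _)]
  have h4 : ∫⁻ ω, (2 ^ n : ℝ≥0∞)⁻¹ * ∑ s : Fin n → Bool, ‖∑ j, boolSign (s j) • D (ω j)‖ₑ ^ q ∂ν
      ≤ ENNReal.ofReal (momentConst k q τ * n ^ (q / p - 1)) *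
        (n * eLpNorm a (ENNReal.ofReal q) μ ^ q) := by
    refine (lintegral_mono h3).trans (le_of_eq ?_)
    rw [lintegral_const_mul' _ _ ENNReal.ofReal_ne_top, lintegral_finsetSum' _ fun j _ => by
      exact (ham.comp_measurePreserving (heval j)).enorm.pow_const q]
    simp [haj]
  rw [← ENNReal.rpow_le_rpow_iff hq0, ENNReal.mul_rpow_of_nonneg _ _ hq0.le]
  refine (h2.trans (mul_le_mul' le_rfl h4)).trans (le_of_eq ?_)
  rcases Nat.eq_zero_or_pos n with rfl | hn
  · have : p⁻¹ ≠ 0 := by positivity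
    simp [Real.zero_rpow this, ENNReal.zero_rpow_of_pos hq0]
  have hn' : (0 : ℝ) < n := by exact_mod_cast hn
  have hmc := momentConst_nonneg k hq0.le hτ
  rw [← mul_assoc, ← mul_assoc, ENNReal.ofReal_rpow_of_nonneg (by positivity) hq0.le]
  congr 1
  rw [← ENNReal.ofReal_natCast n, ← ENNReal.ofReal_ofNat 2,
    ENNReal.ofReal_rpow_of_nonneg (by norm_num) hq0.le, ← ENNReal.ofReal_mul (by positivity),
    ← ENNReal.ofReal_mul (by positivity), Real.mul_rpow (by positivity) (by positivity),
    Real.mul_rpow (by positivity) (by positivity), ← Real.rpow_mul hmc, ← Real.rpow_mul hn'.le,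
    one_div_mul_cancel hq0.ne', Real.rpow_one, Real.rpow_sub_one hn'.ne', one_div_mul_eq_div]
  congr 1
  field_simp

theorem eLpNorm_monteCarlo_sub_le (hk : 1 ≤ k) {p q τ : ℝ} (hp : 1 ≤ p) (hp2 : p ≤ 2)
    (hq : p ≤ q) (hτ : 0 ≤ τ) (hE : HasRademacherTypeWith p τ E) {X Y : Ω → E}
    (hX : AEStronglyMeasurable X μ) (hY : AEStronglyMeasurable Y μ)
    (hD : Integrable (fun ω => tensorPow k (X ω) - tensorPow k (Y ω)) μ)
    {ξ : ℕ → Ω → SymInjTensor k E}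
    (hξ : ∀ j, IdentDistrib (ξ j) (fun ω => tensorPow k (X ω) - tensorPow k (Y ω)) μ μ)
    (hind : iIndepFun ξ μ) {n : ℕ} (hn : 1 ≤ n) :
    eLpNorm (fun ω => (n : ℝ)⁻¹ • ∑ j ∈ Finset.range n, ξ j ω
        - ∫ x, (tensorPow k (X x) - tensorPow k (Y x)) ∂μ) (ENNReal.ofReal q) μ
      ≤ ENNReal.ofReal (2 * momentConst k q τ ^ (1 / q) * n ^ (1 / p - 1))
        * eLpNorm (fun ω => powDist k (X ω) (Y ω)) (ENNReal.ofReal q) μ := by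
  have hn0 : (0 : ℝ) < n := by exact_mod_cast hn
  have hmc := momentConst_nonneg k (q := q) (by linarith) hτ
  set c := ∫ x, (tensorPow k (X x) - tensorPow k (Y x)) ∂μ with hc
  have e1 : (fun ω => (n : ℝ)⁻¹ • ∑ j ∈ Finset.range n, ξ j ω - c)
      = (n : ℝ)⁻¹ • fun ω => ∑ j : Fin n, (ξ j ω - c) := by
    ext1 ω
    simp only [Pi.smul_apply]
    rw [Finset.sum_sub_distrib, Finset.sum_const, Finset.card_univ, Fintype.card_fin, smul_sub,
      ← Nat.cast_smul_eq_nsmul ℝ, smul_smul, inv_mul_cancel₀ hn0.ne', one_smul,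
      Fin.sum_univ_eq_sum_range (fun j => ξ j ω) n]
  rw [e1, eLpNorm_const_smul, eLpNorm_sum_sub_eq_pi hD.1 (fun j => hξ j)
    (hind.precomp Fin.val_injective) c]
  refine (mul_le_mul' le_rfl (eLpNorm_sum_tensorPow_sub_le hk hp hp2 hq hτ hE hX hY hD n)).trans
    (le_of_eq ?_)
  rw [← mul_assoc, Real.enorm_of_nonneg (by positivity), ← ENNReal.ofReal_mul (by positivity),
    Real.rpow_sub_one hn0.ne']
  congr 2
  field_simp

end MonteCarlo

/-! ### Choice of the finest level and the sample numbers -/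

section LevelChoice

variable {A : ℝ}

theorem one_sub_rpow_neg_pos (hA : 1 < A) {θ : ℝ} (hθ : 0 < θ) : 0 < 1 - A ^ (-θ) :=
  sub_pos.2 (Real.rpow_lt_one_of_one_lt_of_neg hA (by linarith))

theorem sum_rpow_mul_le (hA : 1 < A) {θ : ℝ} (hθ : 0 < θ) (L : ℕ) :
    ∑ l ∈ Finset.Icc 1 L, A ^ (θ * l) ≤ (1 - A ^ (-θ))⁻¹ * A ^ (θ * L) := by
  have hA0 : 0 < A := by linarith
  have h := one_sub_rpow_neg_pos hA hθ
  induction L with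
  | zero => simpa using h.le
  | succ L ih =>
    rw [Finset.sum_Icc_succ_top (by omega)]
    have e : A ^ (θ * L) = A ^ (-θ) * A ^ (θ * (L + 1 : ℕ)) := by
      rw [← Real.rpow_add hA0]
      push_cast
      ring_nf
    rw [e] at ih
    refine (add_le_add_left ih _).trans (le_of_eq ?_)
    field_simp
    ring

theorem sum_rpow_neg_mul_le (hA : 1 < A) {θ : ℝ} (hθ : 0 < θ) (L : ℕ) :
    ∑ l ∈ Finset.Icc 1 L, A ^ (-(θ * l)) ≤ (1 - A ^ (-θ))⁻¹ := by
  have hA0 : 0 < A := by linarith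
  have h := one_sub_rpow_neg_pos hA hθ
  -- Subtracting the tail makes the bound inductive.
  suffices hs : ∑ l ∈ Finset.Icc 1 L, A ^ (-(θ * l)) ≤ (1 - A ^ (-θ))⁻¹ * (1 - A ^ (-(θ * L))) by
    refine hs.trans (mul_le_of_le_one_right (by positivity) ?_)
    have : 0 < A ^ (-(θ * L)) := by positivity
    linarith
  induction L with
  | zero => simp
  | succ L ih =>
    rw [Finset.sum_Icc_succ_top (by omega)]
    have e : A ^ (-(θ * (L + 1 : ℕ))) = A ^ (-θ) * A ^ (-(θ * L)) := by
      rw [← Real.rpow_add hA0]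
      push_cast
      ring_nf
    rw [e]
    refine (add_le_add_left ih _).trans ?_
    have h1 : A ^ (-θ) ≤ 1 := by linarith
    have h2 : 0 < A ^ (-(θ * L)) := by positivity
    rw [← sub_nonneg]
    have e2 : (1 - A ^ (-θ))⁻¹ * (1 - A ^ (-θ) * A ^ (-(θ * L)))
        - ((1 - A ^ (-θ))⁻¹ * (1 - A ^ (-(θ * L))) + A ^ (-θ) * A ^ (-(θ * L)))
        = (1 - A ^ (-θ)) * A ^ (-(θ * L)) := by
      field_simp
      ring
    rw [e2]
    positivity

/-- Choice of the sample numbers: weights `g` distribute the error over the levels. -/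
theorem exists_sample_sizes {β γ p' b W ε : ℝ} (hA : 1 < A) (hp' : 0 < p') (hb : 0 < b)
    (hW : 0 < W) (hε : 0 < ε) (L : ℕ) {g : ℕ → ℝ} (hg : ∀ l, 0 < g l)
    (hgW : ∑ l ∈ Finset.Icc 1 L, (g l)⁻¹ ≤ W) :
    ∃ M : ℕ → ℕ, (∀ l, 1 ≤ M l) ∧
      ∑ l ∈ Finset.Icc 1 L, b * (M l : ℝ) ^ (-(1 / p')) * A ^ (-(β * l)) ≤ ε / 2 ∧
      ∑ l ∈ Finset.Icc 1 L, (M l : ℝ) * A ^ (γ * l) ≤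
        (2 * b * W) ^ p' * ε ^ (-p') * ∑ l ∈ Finset.Icc 1 L, g l ^ p' * A ^ ((γ - β * p') * l)
          + ∑ l ∈ Finset.Icc 1 L, A ^ (γ * l) := by
  have hA0 : 0 < A := by linarith
  -- With `M l ≥ (x l)^p'`, level `l` contributes at most `ε / (2 W g l)` to the error. Rounding up
  -- costs one extra sample per level, the source of the sum of `A ^ (γ * l)` and ultimately of
  -- `ε^(-γ/α)`.
  set x : ℕ → ℝ := fun l => 2 * b * W * A ^ (-(β * l)) * g l / ε with hx
  have hx0 : ∀ l, 0 < x l := fun l => by have := hg l; positivity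
  have hM : ∀ l, x l ^ p' ≤ (⌈x l ^ p'⌉₊ : ℝ) := fun l => Nat.le_ceil _
  refine ⟨fun l => ⌈x l ^ p'⌉₊, fun l => Nat.ceil_pos.2 (Real.rpow_pos_of_pos (hx0 l) _), ?_, ?_⟩
  · calc ∑ l ∈ Finset.Icc 1 L, b * (⌈x l ^ p'⌉₊ : ℝ) ^ (-(1 / p')) * A ^ (-(β * l))
        ≤ ∑ l ∈ Finset.Icc 1 L, ε / (2 * W) * (g l)⁻¹ := by
          refine Finset.sum_le_sum fun l _ => ?_
          have h1 : (⌈x l ^ p'⌉₊ : ℝ) ^ (-(1 / p')) ≤ (x l)⁻¹ := by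
            refine (Real.rpow_le_rpow_of_nonpos (Real.rpow_pos_of_pos (hx0 l) _) (hM l)
              (by rw [neg_nonpos]; positivity)).trans (le_of_eq ?_)
            rw [← Real.rpow_mul (hx0 l).le, mul_neg, mul_one_div_cancel hp'.ne', Real.rpow_neg_one]
          calc _ ≤ b * (x l)⁻¹ * A ^ (-(β * l)) := by gcongr
            _ = _ := by
              have := hg l
              have : 0 < A ^ (-(β * l)) := by positivity
              simp only [hx]
              field_simp
      _ = ε / (2 * W) * ∑ l ∈ Finset.Icc 1 L, (g l)⁻¹ := by rw [Finset.mul_sum]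
      _ ≤ ε / (2 * W) * W := by gcongr
      _ = ε / 2 := by field_simp
  · rw [Finset.mul_sum, ← Finset.sum_add_distrib]
    refine Finset.sum_le_sum fun l _ => ?_
    have h1 := (Nat.ceil_lt_add_one (Real.rpow_pos_of_pos (hx0 l) p').le).le
    have h2 : x l ^ p' * A ^ (γ * l)
        = (2 * b * W) ^ p' * ε ^ (-p') * (g l ^ p' * A ^ ((γ - β * p') * l)) := by
      have hgl := hg l
      simp only [hx]
      rw [Real.div_rpow (by positivity) hε.le, Real.mul_rpow (by positivity) hgl.le,
        Real.mul_rpow (by positivity) (by positivity), ← Real.rpow_mul hA0.le, Real.rpow_neg hε.le,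
        show (γ - β * p') * l = -(β * l) * p' + γ * l by ring, Real.rpow_add hA0]
      ring
    calc _ ≤ (x l ^ p' + 1) * A ^ (γ * l) := by gcongr
      _ = _ := by rw [add_mul, one_mul, h2]

theorem exists_level {α a : ℝ} (hA : 1 < A) (hα : 0 < α) (ha : 0 < a) :
    ∃ C, 1 ≤ C ∧ ∀ ε : ℝ, 0 < ε → ε ≤ 1 / 2 → ∃ L : ℕ, 1 ≤ L ∧
      a * A ^ (-(α * L)) < ε / 2 ∧ A ^ (α * L) ≤ C * ε⁻¹ := by
  have hA0 : 0 < A := by linarith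
  have h1 : 1 ≤ A ^ (2 * α) := Real.one_le_rpow hA.le (by positivity)
  -- The factor `A ^ (2 * α)` pays for the ceiling and for the extra level below. The `4` leaves a
  -- bias of at most `ε/4`, hence strict inequality, and the `+ 1` covers a negative logarithm.
  refine ⟨A ^ (2 * α) * (4 * a + 1), by nlinarith, fun ε hε hε2 => ?_⟩
  have hpos : 0 < 4 * a / ε := by positivity
  have hlog : A ^ Real.logb A (4 * a / ε) = 4 * a / ε := Real.rpow_logb hA0 hA.ne' hpos
  refine ⟨⌈Real.logb A (4 * a / ε) / α⌉₊ + 1, by omega, ?_, ?_⟩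
  · have h2 : Real.logb A (4 * a / ε) ≤ α * (⌈Real.logb A (4 * a / ε) / α⌉₊ + 1 : ℕ) := by
      have := Nat.le_ceil (Real.logb A (4 * a / ε) / α)
      rw [div_le_iff₀ hα] at this
      push_cast
      linarith
    have h3 := Real.rpow_le_rpow_of_exponent_le hA.le h2
    rw [hlog] at h3
    rw [Real.rpow_neg hA0.le, ← div_eq_mul_inv, div_lt_iff₀ (by positivity)]
    rw [div_le_iff₀ hε] at h3
    linarith
  · have h2 : α * (⌈Real.logb A (4 * a / ε) / α⌉₊ + 1 : ℕ)
        ≤ 2 * α + max (Real.logb A (4 * a / ε)) 0 := by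
      push_cast
      rcases le_total (Real.logb A (4 * a / ε)) 0 with h | h
      · rw [Nat.ceil_eq_zero.2 (div_nonpos_of_nonpos_of_nonneg h hα.le), max_eq_right h]
        push_cast
        linarith
      · have := (Nat.ceil_lt_add_one (div_nonneg h hα.le)).le
        rw [max_eq_left h]
        calc _ ≤ α * (Real.logb A (4 * a / ε) / α + 1 + 1) := by gcongr
          _ = _ := by field_simp; ring
    refine (Real.rpow_le_rpow_of_exponent_le hA.le h2).trans ?_
    rw [Real.rpow_add hA0, mul_assoc]
    gcongr
    have h4 : 1 ≤ ε⁻¹ := (one_le_inv₀ hε).2 (by linarith)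
    rcases le_total (Real.logb A (4 * a / ε)) 0 with h | h
    · rw [max_eq_right h, Real.rpow_zero]
      nlinarith
    · rw [max_eq_left h, hlog, div_eq_mul_inv]
      nlinarith

/-- Choice of the finest level and of the sample numbers in the multilevel method. -/
theorem exists_levels_and_sample_sizes {α β γ p' a b : ℝ} (hA : 1 < A) (hα : 0 < α) (hγ : 0 < γ)
    (hp' : 0 < p') (ha : 0 < a) (hb : 0 < b) :
    ∃ K, 0 < K ∧ ∀ ε : ℝ, 0 < ε → ε ≤ 1 / 2 → ∃ (L : ℕ) (M : ℕ → ℕ), 1 ≤ L ∧ (∀ l, 1 ≤ M l) ∧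
      a * A ^ (-(α * L)) + ∑ l ∈ Finset.Icc 1 L, b * (M l : ℝ) ^ (-(1 / p')) * A ^ (-(β * l)) < ε ∧
      ∑ l ∈ Finset.Icc 1 L, (M l : ℝ) * A ^ (γ * l) ≤ K * costRate α β γ A p' ε := by
  have hA0 : 0 < A := by linarith
  obtain ⟨C, hC1, hC⟩ := exists_level hA hα ha
  have hC0 : 0 < C := by linarith
  have hpow : ∀ (ε : ℝ) (L : ℕ), 0 < ε → A ^ (α * L) ≤ C * ε⁻¹ → ∀ θ : ℝ, 0 ≤ θ →
      A ^ (θ * L) ≤ C ^ (θ / α) * ε ^ (-(θ / α)) := by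
    intro ε L hε hL θ hθ
    have h := Real.rpow_le_rpow (by positivity) hL (show 0 ≤ θ / α by positivity)
    rw [← Real.rpow_mul hA0.le, Real.mul_rpow hC0.le (by positivity), Real.inv_rpow hε.le,
      ← Real.rpow_neg hε.le, mul_right_comm, mul_div_cancel₀ _ hα.ne'] at h
    exact h
  have hG := one_sub_rpow_neg_pos hA hγ
  set K₁ := (1 - A ^ (-γ))⁻¹ * C ^ (γ / α) with hK₁
  have hK₁0 : 0 < K₁ := by positivity
  have hsumγ : ∀ (ε : ℝ) (L : ℕ), 0 < ε → A ^ (α * L) ≤ C * ε⁻¹ →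
      ∑ l ∈ Finset.Icc 1 L, A ^ (γ * l) ≤ K₁ * ε ^ (-(γ / α)) := by
    intro ε L hε hL
    refine (sum_rpow_mul_le hA hγ L).trans ?_
    rw [hK₁, mul_assoc]
    gcongr
    exact hpow ε L hε hL γ hγ.le
  -- The difference with `costRate` isolates the summand that depends on the case; the rounding cost
  -- is already controlled by `K₁`.
  suffices h : ∃ K₂, 0 < K₂ ∧ ∀ (ε : ℝ) (L : ℕ), 0 < ε → ε ≤ 1 / 2 → 1 ≤ L →
      A ^ (α * L) ≤ C * ε⁻¹ → ∃ M : ℕ → ℕ, (∀ l, 1 ≤ M l) ∧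
        ∑ l ∈ Finset.Icc 1 L, b * (M l : ℝ) ^ (-(1 / p')) * A ^ (-(β * l)) ≤ ε / 2 ∧
        ∑ l ∈ Finset.Icc 1 L, (M l : ℝ) * A ^ (γ * l) ≤
          K₂ * (costRate α β γ A p' ε - ε ^ (-(γ / α)))
          + ∑ l ∈ Finset.Icc 1 L, A ^ (γ * l) by
    obtain ⟨K₂, hK₂, h⟩ := h
    refine ⟨K₁ + K₂, by positivity, fun ε hε hε2 => ?_⟩
    obtain ⟨L, hL1, hLa, hLC⟩ := hC ε hε hε2
    obtain ⟨M, hM1, hM2, hM3⟩ := h ε L hε hε2 hL1 hLC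
    refine ⟨L, M, hL1, hM1, by linarith, ?_⟩
    have h1 := hsumγ ε L hε hLC
    have h2 : 0 < ε ^ (-(γ / α)) := by positivity
    have h3 : ε ^ (-(γ / α)) ≤ costRate α β γ A p' ε := by
      unfold costRate
      split_ifs <;> exact le_add_of_nonneg_right (by positivity)
    nlinarith
  rcases lt_trichotomy γ (β * p') with h | h | h
  -- The weights `A ^ (θ * l)` use half of the geometric decay; the other half keeps the cost sum
  -- bounded in `L`.
  · set θ := (β * p' - γ) / (2 * p') with hθ
    have hθ0 : 0 < θ := div_pos (by linarith) (by positivity)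
    have hθp : 0 < θ * p' := by positivity
    have h1 := one_sub_rpow_neg_pos hA hθ0
    have h2 := one_sub_rpow_neg_pos hA hθp
    refine ⟨(2 * b * (1 - A ^ (-θ))⁻¹) ^ p' * (1 - A ^ (-(θ * p')))⁻¹, by positivity, ?_⟩
    intro ε L hε _ _ _
    obtain ⟨M, hM1, hM2, hM3⟩ := exists_sample_sizes (β := β) (γ := γ) hA hp' hb (inv_pos.2 h1) hε L
      (g := fun l => A ^ (θ * l)) (fun l => by positivity) (by
        simp only [← Real.rpow_neg hA0.le]
        exact sum_rpow_neg_mul_le hA hθ0 L)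
    refine ⟨M, hM1, hM2, hM3.trans ?_⟩
    have e : ∀ l : ℕ, (A ^ (θ * l)) ^ p' * A ^ ((γ - β * p') * l) = A ^ (-(θ * p' * l)) := by
      intro l
      rw [← Real.rpow_mul hA0.le, ← Real.rpow_add hA0]
      congr 1
      rw [hθ]
      field_simp
      ring
    simp only [e]
    rw [costRate, if_pos h, add_sub_cancel_left, mul_right_comm]
    gcongr
    exact sum_rpow_neg_mul_le hA hθp L
  · have hlog2 : 0 < Real.logb A 2 := Real.logb_pos hA (by norm_num)
    have hlogC : 0 ≤ Real.logb A C := Real.logb_nonneg hA hC1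
    set C' := (Real.logb A C / Real.logb A 2 + 1) / α with hC'
    have hC'0 : 0 < C' := by positivity
    refine ⟨(2 * b * 1) ^ p' * C' ^ (p' + 1), by positivity, ?_⟩
    intro ε L hε hε2 hL1 hLC
    have hL0 : (0 : ℝ) < L := by exact_mod_cast hL1
    have hL : (L : ℝ) ≤ C' * |Real.logb A ε| := by
      -- Here `ε ≤ 1/2` is essential: it keeps `|log_A ε|` away from zero, so that additive
      -- constants can be absorbed.
      have h1 : Real.logb A 2 ≤ - Real.logb A ε := by
        rw [← Real.logb_inv]
        exact Real.logb_le_logb_of_le hA (by norm_num) (by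
          rw [le_inv_comm₀ (by norm_num) hε]; linarith)
      have h2 : α * L ≤ Real.logb A C - Real.logb A ε := by
        rw [← Real.logb_div hC0.ne' hε.ne', Real.le_logb_iff_rpow_le hA (by positivity),
          div_eq_mul_inv]
        exact hLC
      rw [abs_of_nonpos (by linarith), hC', div_mul_eq_mul_div, le_div_iff₀ hα, add_mul, one_mul,
        div_mul_eq_mul_div]
      have h3 : Real.logb A C ≤ Real.logb A C * -Real.logb A ε / Real.logb A 2 := by
        rw [le_div_iff₀ hlog2]
        gcongr
      linarith
    -- Without decay or growth the error is shared equally: `L` terms `L ^ p'` give `L ^ (p' + 1)`,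
    -- which is the power of the logarithm.
    obtain ⟨M, hM1, hM2, hM3⟩ := exists_sample_sizes (β := β) (γ := γ) hA hp' hb one_pos hε L
      (g := fun _ => L) (fun l => hL0) (by
        rw [Finset.sum_const, Nat.card_Icc, Nat.add_sub_cancel, nsmul_eq_mul,
          mul_inv_cancel₀ hL0.ne'])
    refine ⟨M, hM1, hM2, hM3.trans ?_⟩
    rw [costRate, if_neg (by linarith), if_pos h.symm, add_sub_cancel_left, h, sub_self]
    simp only [zero_mul, Real.rpow_zero, mul_one, Finset.sum_const, Nat.card_Icc,
      Nat.add_sub_cancel, nsmul_eq_mul]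
    rw [mul_comm (L : ℝ), ← Real.rpow_add_one hL0.ne']
    have h4 := Real.rpow_le_rpow hL0.le hL (show 0 ≤ p' + 1 by positivity)
    rw [Real.mul_rpow hC'0.le (abs_nonneg _)] at h4
    have h5 : 0 ≤ (2 * b) ^ p' * ε ^ (-p') := by positivity
    have h6 := mul_le_mul_of_nonneg_left h4 h5
    linarith
  · set θ := (γ - β * p') / (2 * p') with hθ
    have hθ0 : 0 < θ := div_pos (by linarith) (by positivity)
    have hθp : 0 < θ * p' := by positivity
    have h1 := one_sub_rpow_neg_pos hA hθ0
    have h2 := one_sub_rpow_neg_pos hA hθp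
    refine ⟨(2 * b * (1 - A ^ (-θ))⁻¹) ^ p' *
      ((1 - A ^ (-(θ * p')))⁻¹ * C ^ ((γ - β * p') / α)), by positivity, ?_⟩
    intro ε L hε _ _ hLC
    -- The finest level dominates the cost, so weights decreasing towards `L` grant it the largest
    -- share of the error.
    obtain ⟨M, hM1, hM2, hM3⟩ := exists_sample_sizes (β := β) (γ := γ) hA hp' hb (inv_pos.2 h1) hε L
      (g := fun l => A ^ (θ * L - θ * l)) (fun l => by positivity) (by
        have e : ∀ l : ℕ, (A ^ (θ * L - θ * l))⁻¹ = (A ^ (θ * L))⁻¹ * A ^ (θ * l) := by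
          intro l
          rw [Real.rpow_sub hA0, inv_div, div_eq_inv_mul]
        simp only [e]
        rw [← Finset.mul_sum, inv_mul_le_iff₀ (by positivity), mul_comm]
        exact sum_rpow_mul_le hA hθ0 L)
    refine ⟨M, hM1, hM2, hM3.trans ?_⟩
    have e : ∀ l : ℕ, (A ^ (θ * L - θ * l)) ^ p' * A ^ ((γ - β * p') * l)
        = A ^ (θ * p' * L) * A ^ (θ * p' * l) := by
      intro l
      rw [← Real.rpow_mul hA0.le, ← Real.rpow_add hA0, ← Real.rpow_add hA0]
      congr 1
      rw [hθ]
      field_simp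
      ring
    have e2 : ε ^ (-p' - (γ - β * p') / α) = ε ^ (-p') * ε ^ (-((γ - β * p') / α)) := by
      rw [← Real.rpow_add hε, sub_eq_add_neg]
    have h3 : ∑ l ∈ Finset.Icc 1 L, A ^ (θ * p' * L) * A ^ (θ * p' * l)
        ≤ (1 - A ^ (-(θ * p')))⁻¹ * (C ^ ((γ - β * p') / α) * ε ^ (-((γ - β * p') / α))) := by
      rw [← Finset.mul_sum]
      calc _ ≤ A ^ (θ * p' * L) * ((1 - A ^ (-(θ * p')))⁻¹ * A ^ (θ * p' * L)) := by
            gcongr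
            exact sum_rpow_mul_le hA hθp L
        _ = (1 - A ^ (-(θ * p')))⁻¹ * A ^ ((γ - β * p') * L) := by
            rw [mul_left_comm, ← Real.rpow_add hA0]
            congr 2
            rw [hθ]
            field_simp
            ring
        _ ≤ _ := by
            gcongr
            exact hpow ε L hε hLC _ (by linarith)
    simp only [e]
    rw [costRate, if_neg (by linarith), if_neg (by linarith), add_sub_cancel_left, e2]
    have h5 : 0 ≤ (2 * b * (1 - A ^ (-θ))⁻¹) ^ p' * ε ^ (-p') := by positivity
    have h6 := mul_le_mul_of_nonneg_left h3 h5
    linarith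

end LevelChoice

/-! ### Telescoping over the levels -/

section Multilevel

variable {E : Type*} [NormedAddCommGroup E] [NormedSpace ℝ E] {k : ℕ}
  {Ω : Type*} [MeasurableSpace Ω] {μ : Measure Ω} [IsProbabilityMeasure μ]

theorem sum_integral_levelDiff {Ω : Type*} [MeasurableSpace Ω] {μ : Measure Ω} (hk : 1 ≤ k) {X : ℕ → Ω → E} (h0 : ∀ ω, X 0 ω = 0)
    (hX : ∀ l, Integrable (fun ω => tensorPow k (X l ω)) μ) (L : ℕ) :
    ∑ l ∈ Finset.Icc 1 L, ∫ ω, levelDiff k X l ω ∂μ = injMoment k (X L) μ := by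
  induction L with
  | zero => simp [injMoment, h0, tensorPow_zero hk]
  | succ L ih =>
    rw [Finset.sum_Icc_succ_top (by omega), ih]
    unfold injMoment levelDiff
    rw [integral_sub (hX _) (hX _), Nat.add_sub_cancel, add_sub_cancel]

/-- The multilevel error is bounded by the bias plus the sampling errors of the levels. -/
theorem eLpNorm_mlmc_error_le (hk : 1 ≤ k) {Y : Ω → E} {X : ℕ → Ω → E} (h0 : ∀ ω, X 0 ω = 0)
    (hX : ∀ l, Integrable (fun ω => tensorPow k (X l ω)) μ) {ξ : ℕ → ℕ → Ω → SymInjTensor k E}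
    {q : ℝ} (hq : 1 ≤ q) (L : ℕ) (hξ : ∀ l, 1 ≤ l → ∀ j, AEStronglyMeasurable (ξ l j) μ)
    (M : ℕ → ℕ) :
    eLpNorm (fun ω => injMoment k Y μ - mlmcEstimator ξ L M ω) (ENNReal.ofReal q) μ
      ≤ ENNReal.ofReal ‖injMoment k Y μ - injMoment k (X L) μ‖
        + ∑ l ∈ Finset.Icc 1 L, eLpNorm (fun ω => (M l : ℝ)⁻¹ • ∑ j ∈ Finset.range (M l), ξ l j ω
          - ∫ x, levelDiff k X l x ∂μ) (ENNReal.ofReal q) μ := by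
  have hq1 : 1 ≤ ENNReal.ofReal q := by simpa using hq
  have hm : ∀ l ∈ Finset.Icc 1 L, AEStronglyMeasurable (fun ω =>
      (M l : ℝ)⁻¹ • ∑ j ∈ Finset.range (M l), ξ l j ω - ∫ x, levelDiff k X l x ∂μ) μ := by
    intro l hl
    have h : AEStronglyMeasurable (fun ω => ∑ j ∈ Finset.range (M l), ξ l j ω) μ :=
      Finset.aestronglyMeasurable_fun_sum _ fun j _ => hξ l (Finset.mem_Icc.1 hl).1 j
    exact (h.const_smul ((M l : ℝ)⁻¹)).sub aestronglyMeasurable_const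
  have e : (fun ω => injMoment k Y μ - mlmcEstimator ξ L M ω)
      = (fun _ => injMoment k Y μ - injMoment k (X L) μ) - ∑ l ∈ Finset.Icc 1 L, fun ω =>
        ((M l : ℝ)⁻¹ • ∑ j ∈ Finset.range (M l), ξ l j ω - ∫ x, levelDiff k X l x ∂μ) := by
    ext1 ω
    simp only [Pi.sub_apply, Finset.sum_apply, Finset.sum_sub_distrib]
    rw [sum_integral_levelDiff hk h0 hX L, mlmcEstimator]
    abel
  rw [e]
  refine (eLpNorm_sub_le aestronglyMeasurable_const (Finset.aestronglyMeasurable_sum _ hm)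
    hq1).trans ?_
  refine add_le_add (le_of_eq ?_) (eLpNorm_sum_le hm hq1)
  rw [eLpNorm_const _ (by simp; linarith) (IsProbabilityMeasure.ne_zero μ), measure_univ,
    ENNReal.one_rpow, mul_one, ofReal_norm]

end Multilevel

theorem momentConst_pos {k : ℕ} (hk : 1 ≤ k) {q τ : ℝ} (hq : 0 < q) (hτ : 0 ≤ τ) :
    0 < momentConst k q τ := by
  have : (0 : ℝ) < k := by exact_mod_cast hk
  unfold momentConst
  positivity

end

/-- The constant `K` depends only on the displayed parameters; `τ` bounds the type `p` constant of
`E`, and `c₁, c₂` are the constants in `N_ℓ ≍ A ^ ℓ`. -/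
theorem mainTheorem3
    (p p' q : ℝ) (hp : 1 < p) (hp2 : p ≤ 2) (hpp' : 1 / p + 1 / p' = 1) (hq : p ≤ q)
    (k : ℕ) (hk : 1 ≤ k)
    (α β γ A Cα Cβ Cγ Cstab c₁ c₂ τ : ℝ)
    (hα : 0 < α) (hβ : 0 < β) (hγ : 0 < γ) (hA : 1 < A)
    (hCα : 0 < Cα) (hCβ : 0 < Cβ) (hCγ : 0 < Cγ) (hCstab : 0 < Cstab)
    (hc₁ : 0 < c₁) (hc₂ : 0 < c₂) (hτ : 0 < τ) :
    ∃ K : ℝ, 0 < K ∧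
      ∀ (E : Type u) [NormedAddCommGroup E] [NormedSpace ℝ E] [CompleteSpace E],
        HasRademacherTypeWith p τ E →
      ∀ (Ω : Type v) [MeasurableSpace Ω] (μ : Measure Ω) [IsProbabilityMeasure μ]
        (X : Ω → E) (Xs : ℕ → Ω → E) (ξ : ℕ → ℕ → Ω → SymInjTensor k E)
        (cost : ℕ → ℝ) (N : ℕ → ℕ),
        MemLp X (k : ℝ≥0∞) μ →
        (∀ ω, Xs 0 ω = 0) →
        (∀ l, 1 ≤ l → MemLp (Xs l) (ENNReal.ofReal (k * q)) μ) →
        -- the discretization parameters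
        (∀ l, 1 ≤ l → 0 < N l) →
        (∀ l, 1 ≤ l → c₁ * A ^ l ≤ N l ∧ (N l : ℝ) ≤ c₂ * A ^ l) →
        -- decay of the bias, decay of the level differences, cost per sample, stability
        (∀ l, 1 ≤ l → ‖injMoment k X μ - injMoment k (Xs l) μ‖ ≤ Cα * (N l : ℝ) ^ (-α)) →
        (∀ l, 1 ≤ l → eLpNorm (fun ω => Xs l ω - Xs (l - 1) ω) (ENNReal.ofReal (k * q)) μ
          ≤ ENNReal.ofReal (Cβ * (N l : ℝ) ^ (-β))) →
        (∀ l, 1 ≤ l → cost l ≤ Cγ * (N l : ℝ) ^ γ) →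
        (∀ l, 1 ≤ l → max (eLpNorm X (k : ℝ≥0∞) μ) (eLpNorm (Xs l) (ENNReal.ofReal (k * q)) μ)
          ≤ ENNReal.ofReal Cstab) →
        -- on each level, independent copies of the level difference
        (∀ l, 1 ≤ l → ∀ j, MemLp (ξ l j) (ENNReal.ofReal q) μ) →
        (∀ l, 1 ≤ l → ∀ j, IdentDistrib (ξ l j) (levelDiff k Xs l) μ μ) →
        (∀ l, 1 ≤ l → iIndepFun (ξ l) μ) →
        ∀ ε : ℝ, 0 < ε → ε ≤ 1 / 2 →
          ∃ (L : ℕ) (M : ℕ → ℕ), 1 ≤ L ∧ (∀ l, 1 ≤ l → l ≤ L → 1 ≤ M l) ∧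
            eLpNorm (fun ω => injMoment k X μ - mlmcEstimator ξ L M ω) (ENNReal.ofReal q) μ
              < ENNReal.ofReal ε ∧
            mlmcCost cost L M ≤ K * costRate α β γ A p' ε := by
  have hA0 : 0 < A := by linarith
  have hq1 : 1 ≤ q := by linarith
  have hq0 : 0 < q := by linarith
  have hp' : 0 < p' := by
    have h1 : 1 / p < 1 := by rw [div_lt_one (by linarith)]; exact hp
    exact one_div_pos.1 (by linarith)
  have hmc := momentConst_pos hk hq0 hτ.le
  -- Collects the single-level constants: the moment inequality, `(2 * Cstab) ^ (k - 1)` from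
  -- Hölder, and the decay of the level differences. None depends on `E` or `Ω`, so `K` is uniform.
  set B := 2 * momentConst k q τ ^ (1 / q) * (2 * Cstab) ^ (k - 1) * Cβ * c₁ ^ (-β) with hB
  obtain ⟨K, hK, hchoice⟩ := exists_levels_and_sample_sizes (β := β) (a := Cα * c₁ ^ (-α)) (b := B)
    hA hα hγ hp' (by positivity) (by positivity)
  refine ⟨Cγ * c₂ ^ γ * K, by positivity, ?_⟩
  intro E _ _ _ hE Ω _ μ _ X Xs ξ cost N _ h0 hXs _ hN hbias hdiff hcost hstab hξ hid hind ε hε hε2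
  obtain ⟨L, M, hL, hM, herr, hc⟩ := hchoice ε hε hε2
  have hX : ∀ l, MemLp (Xs l) (ENNReal.ofReal (k * q)) μ ∧
      eLpNorm (Xs l) (ENNReal.ofReal (k * q)) μ ≤ ENNReal.ofReal Cstab := by
    intro l
    rcases Nat.eq_zero_or_pos l with rfl | hl
    · rw [show Xs 0 = 0 from funext h0]
      exact ⟨MemLp.zero, by simp⟩
    · exact ⟨hXs l hl, (le_max_right _ _).trans (hstab l hl)⟩
  have hint : ∀ l, Integrable (fun ω => tensorPow k (Xs l ω)) μ := fun l =>
    (memLp_tensorPow hk hq0 (hX l).1).integrable (by simpa using hq1)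
  have hNpow : ∀ l, 1 ≤ l → ∀ s : ℝ, 0 < s → (N l : ℝ) ^ (-s) ≤ c₁ ^ (-s) * A ^ (-(s * l)) := by
    intro l hl s hs
    refine (Real.rpow_le_rpow_of_nonpos (by positivity) (hN l hl).1 (by linarith)).trans
      (le_of_eq ?_)
    rw [Real.mul_rpow hc₁.le (by positivity), ← Real.rpow_natCast, ← Real.rpow_mul hA0.le]
    ring_nf
  refine ⟨L, M, hL, fun l _ _ => hM l, ?_, ?_⟩
  · refine (eLpNorm_mlmc_error_le hk h0 hint hq1 L (fun l hl j => (hξ l hl j).1) M).trans_lt ?_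
    refine lt_of_le_of_lt ?_ ((ENNReal.ofReal_lt_ofReal_iff hε).2 herr)
    rw [ENNReal.ofReal_add (by positivity) (Finset.sum_nonneg fun l _ => by positivity),
      ENNReal.ofReal_sum_of_nonneg fun l _ => by positivity]
    refine add_le_add (ENNReal.ofReal_le_ofReal ?_) (Finset.sum_le_sum fun l hl => ?_)
    · refine (hbias L hL).trans ?_
      rw [mul_assoc]
      gcongr
      exact hNpow L hL α hα
    · have hl1 := (Finset.mem_Icc.1 hl).1
      refine (eLpNorm_monteCarlo_sub_le hk hp.le hp2 hq hτ.le hE (hX l).1.1 (hX (l - 1)).1.1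
        ((hint l).sub (hint (l - 1))) (hid l hl1) (hind l hl1) (hM l)).trans ?_
      refine (mul_le_mul' le_rfl (eLpNorm_powDist_le hk hq1 (hX l).1.1 (hX (l - 1)).1.1 (hX l).2
        (hX (l - 1)).2 (hdiff l hl1))).trans ?_
      rw [← ENNReal.ofReal_ofNat 2, ← ENNReal.ofReal_mul (by norm_num),
        ← ENNReal.ofReal_pow (by positivity), ← ENNReal.ofReal_mul (by positivity),
        ← ENNReal.ofReal_mul (by positivity)]
      apply ENNReal.ofReal_le_ofReal
      rw [show 1 / p - 1 = -(1 / p') by linarith]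
      calc _ ≤ 2 * momentConst k q τ ^ (1 / q) * (M l : ℝ) ^ (-(1 / p')) *
            ((2 * Cstab) ^ (k - 1) * (Cβ * (c₁ ^ (-β) * A ^ (-(β * l))))) := by
            gcongr
            exact hNpow l hl1 β hβ
        _ = _ := by rw [hB]; ring
  · calc mlmcCost cost L M
        ≤ ∑ l ∈ Finset.Icc 1 L, Cγ * c₂ ^ γ * ((M l : ℝ) * A ^ (γ * l)) := by
          refine Finset.sum_le_sum fun l hl => ?_
          have hl1 := (Finset.mem_Icc.1 hl).1
          have h1 : (N l : ℝ) ^ γ ≤ c₂ ^ γ * A ^ (γ * l) := by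
            refine (Real.rpow_le_rpow (by positivity) (hN l hl1).2 hγ.le).trans (le_of_eq ?_)
            rw [Real.mul_rpow hc₂.le (by positivity), ← Real.rpow_natCast, ← Real.rpow_mul hA0.le,
              mul_comm (l : ℝ)]
          calc (M l : ℝ) * cost l ≤ M l * (Cγ * (c₂ ^ γ * A ^ (γ * l))) := by
                gcongr
                exact (hcost l hl1).trans (by gcongr)
            _ = _ := by ring
      _ = Cγ * c₂ ^ γ * ∑ l ∈ Finset.Icc 1 L, (M l : ℝ) * A ^ (γ * l) := by rw [Finset.mul_sum]
      _ ≤ Cγ * c₂ ^ γ * (K * costRate α β γ A p' ε) := by gcongr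
      _ = _ := by ring
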